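/- Let $n\ge 1$ and let $\Omega\subset\mathbb R^n$ be a bounded Lipschitz open set, i.e. each point of $\partial\Omega$ has a neighbourhood in which, in a suitable orthonormal frame, $\Omega$ is the set of points lying strictly on one side of the graph of a Lipschitz function. Let $\mathcal H^{n-1}$ be the $(n-1)$-dimensional Hausdorff measure and, for $1\le p<\infty$, write $L^p(\partial\Omega)=L^p(\partial\Omega,\mathcal H^{n-1})$. A function $g\in L^p(\partial\Omega)$ is called a trace of $u\in W^{1,p}(\Omega)$ if there are $\varphi_k\in C^\infty(\mathbb R^n)$ with $\varphi_k\to u$ in $W^{1,p}(\Omega)$ and $\varphi_k|_{\partial\Omega}\to g$ in $L^p(\partial\Omega)$. Then: 1. For every $1\le p<\infty$, every $u\in W^{1,p}(\Omega)$ has a trace, unique up to $\mathcal H^{n-1}$-null sets, denoted $\operatorname{tr}u$. If $u\in W^{1,p}(\Omega)\cap C^0(\overline\Omega)$, then $\operatorname{tr}u=u$ $\mathcal H^{n-1}$-a.e. on $\partial\Omega$. 2. $W^{1,1}_0(\Omega)=\{u\in W^{1,1}(\Omega):\operatorname{tr}u=0\}$, where $W^{1,1}_0(\Omega)$ is the closure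 of $C_c^\infty(\Omega)$ in $W^{1,1}(\Omega)$. -/

import Mathlib

open MeasureTheory Filter Topology
open scoped ENNReal NNReal ContDiff RealInnerProductSpace

namespace SobolevTrace

/-- The Euclidean space of dimension `n`. -/
abbrev E (n : ℕ) : Type := EuclideanSpace ℝ (Fin n)

variable {n : ℕ}

/-- A bounded Lipschitz open set (not necessarily connected): near each boundary point, after a
choice of a unit direction `e`, the set is the strict subgraph, in the direction `e`, of a Lipschitz
function `γ` defined on the hyperplane orthogonal to `e`. -/
def IsLipschitzDomain (Ω : Set (E n)) : Prop :=
  IsOpen Ω ∧ Bornology.IsBounded Ω ∧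
    ∀ x₀ ∈ frontier Ω, ∃ e : E n, ‖e‖ = 1 ∧
      ∃ (K : ℝ≥0) (γ : (ℝ ∙ e)ᗮ → ℝ), LipschitzWith K γ ∧
        ∃ U ∈ 𝓝 x₀, ∀ x ∈ U, x ∈ Ω ↔ ⟪e, x⟫ < γ ((ℝ ∙ e)ᗮ.orthogonalProjectionOnto x)

/-- The surface measure on the boundary: the `(n-1)`-dimensional Hausdorff measure (for the Euclidean
distance) restricted to `∂Ω`. -/
noncomputable def surfaceMeasure (Ω : Set (E n)) : Measure (E n) :=
  (Measure.hausdorffMeasure ((n : ℝ) - 1)).restrict (frontier Ω)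

/-- `φ ∈ C_c^∞(Ω)`. -/
def IsTestFunction (Ω : Set (E n)) (φ : E n → ℝ) : Prop :=
  ContDiff ℝ ∞ φ ∧ HasCompactSupport φ ∧ tsupport φ ⊆ Ω

/-- `G` is the distributional gradient of `u` in `Ω`, tested against `C_c^∞(Ω)`. It is used only
for `u` and `G` in some `L^p(Ω)`, so that all the integrals converge. -/
def IsWeakGradient (Ω : Set (E n)) (u : E n → ℝ) (G : E n → E n) : Prop :=
  ∀ φ : E n → ℝ, IsTestFunction Ω φ → ∀ v : E n,
    ∫ x in Ω, u x * fderiv ℝ φ x v = - ∫ x in Ω, ⟪G x, v⟫ * φ x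

/-- `u ∈ W^{1,p}(Ω)`; only the values of `u` in `Ω` matter, up to null sets. -/
def MemW1 (Ω : Set (E n)) (p : ℝ≥0∞) (u : E n → ℝ) : Prop :=
  MemLp u p (volume.restrict Ω) ∧
    ∃ G : E n → E n, MemLp G p (volume.restrict Ω) ∧ IsWeakGradient Ω u G

/-- The smooth functions `φ k` converge to `u ∈ W^{1,p}(Ω)` in the norm of `W^{1,p}(Ω)`. -/
def SmoothTendstoW1 (Ω : Set (E n)) (p : ℝ≥0∞) (φ : ℕ → E n → ℝ) (u : E n → ℝ) : Prop :=
  (∀ k, ContDiff ℝ ∞ (φ k)) ∧ MemLp u p (volume.restrict Ω) ∧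
    ∃ G : E n → E n, MemLp G p (volume.restrict Ω) ∧ IsWeakGradient Ω u G ∧
      Tendsto (fun k => eLpNorm (fun x => φ k x - u x) p (volume.restrict Ω)) atTop (𝓝 0) ∧
      Tendsto (fun k => eLpNorm (fun x => gradient (φ k) x - G x) p (volume.restrict Ω))
        atTop (𝓝 0)

/-- `u ∈ W^{1,p}_0(Ω)`: the closure of `C_c^∞(Ω)` in `W^{1,p}(Ω)`. -/
def MemW1Zero (Ω : Set (E n)) (p : ℝ≥0∞) (u : E n → ℝ) : Prop :=
  ∃ φ : ℕ → E n → ℝ, (∀ k, IsTestFunction Ω (φ k)) ∧ SmoothTendstoW1 Ω p φ u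

/-- `g ∈ L^p(∂Ω)` is the trace of `u ∈ W^{1,p}(Ω)`: the limit in `L^p(∂Ω)` of the boundary values of
functions in `C^∞(ℝⁿ)` that converge to `u` in `W^{1,p}(Ω)`. -/
def IsTrace (Ω : Set (E n)) (p : ℝ≥0∞) (u g : E n → ℝ) : Prop :=
  MemLp g p (surfaceMeasure Ω) ∧
    ∃ φ : ℕ → E n → ℝ, SmoothTendstoW1 Ω p φ u ∧
      Tendsto (fun k => eLpNorm (fun x => φ k x - g x) p (surfaceMeasure Ω)) atTop (𝓝 0)

end SobolevTrace

namespace SobolevTrace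

variable {n : ℕ}

open scoped Convolution

/-! ### Mollification -/

/-! Near a boundary point, `Ω` is `{h > 0}` with `h` Lipschitz and `h (x - t • e) = h x + t`. Each
line of direction `e` meets the graph `{h = 0}` once, and the graph is a bi-Lipschitz image of the
hyperplane orthogonal to `e`. Fubini therefore makes `∫ f` comparable to the integral over the
graph, for Hausdorff measure, of the line integrals of `f` (`exists_lintegral_graph_comparison`).
The fundamental theorem of calculus along these lines, with compactness of `∂Ω`, gives two estimates
for smooth `φ`: `∫_{∂Ω} |φ|^p ≤ C ∫_Ω (|φ| + |∇φ|)^p` (`exists_trace_inequality`); `∫_{layer δ} |φ|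
≤ C δ (∫_{∂Ω} |φ| + ∫_{layer Mδ} |∇φ|)` (`exists_boundaryLayer_inequality`).

Functions smooth on the whole space are dense in `W^{1,p}(Ω)` (`exists_smooth_approx`): mollify the
extension by zero with kernels displaced so that only values inside `Ω` are sampled, and glue with a
partition of unity. By the first estimate, boundary values of approximating sequences are Cauchy,
and two sequences with the same limit have the same boundary limit. For `u` continuous on the
closure the approximants converge uniformly, so the trace is `u`.

Test functions vanish on `∂Ω`, hence so do the traces of their limits. Conversely, if `φ m → u` in
`W^{1,1}` with boundary values tending to `0`, multiply by cutoffs `χ m` equal to `1` off the layer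
of width `δ m → 0`. The only dangerous term, `φ m ∇χ m`, has norm at most `4 / δ m` times the
integral of `|φ m|` over the layer; the second estimate cancels `δ m` and leaves quantities tending
to `0`. -/

/-- A smooth, compactly supported probability density. -/
structure IsMollifier (k : E n → ℝ) : Prop where
  contDiff : ContDiff ℝ ∞ k
  hasCompactSupport : HasCompactSupport k
  nonneg : ∀ x, 0 ≤ k x
  integral_eq_one : ∫ x, k x = 1

/-- The centre `c` is free because the density argument needs off-centre kernels, which sample a
function at points displaced by about `-c`. -/
theorem exists_isMollifier (c : E n) {ε : ℝ} (hε : 0 < ε) :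
    ∃ k : E n → ℝ, IsMollifier k ∧ Function.support k ⊆ Metric.ball c ε := by
  let φ : ContDiffBump c := ⟨ε / 2, ε, by positivity, by linarith⟩
  refine ⟨φ.normed volume, ⟨φ.contDiff_normed, φ.hasCompactSupport_normed,
    φ.nonneg_normed, φ.integral_normed⟩, ?_⟩
  rw [φ.support_normed_eq]

/-- Translations preserve the measure and depend continuously on `y` in the compact-open topology,
and composition with measure preserving maps is continuous into `Lp` for finite `p`. -/
theorem tendsto_eLpNorm_translate_sub {F : Type*} [NormedAddCommGroup F] {f : E n → F}
    {p : ℝ≥0∞} (hp : 1 ≤ p) (hp' : p ≠ ⊤)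
    (hf : MemLp f p) :
    Tendsto (fun y => eLpNorm (fun x => f (x - y) - f x) p) (𝓝 (0 : E n)) (𝓝 0) := by
  have : Fact (1 ≤ p) := ⟨hp⟩
  have hmp : ∀ y : E n, MeasurePreserving (fun x => x - y) volume volume :=
    fun y => measurePreserving_sub_right volume y
  let c : E n → C(E n, E n) := fun y => ⟨fun x => x - y, by fun_prop⟩
  have hc : Continuous c :=
    ContinuousMap.continuous_of_continuous_uncurry _ (by
      change Continuous fun q : E n × E n => q.2 - q.1
      fun_prop)
  have h := ((continuous_const (y := hf.toLp f)).compMeasurePreservingLp hc hmp hp').tendsto 0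
  rw [tendsto_iff_edist_tendsto_0] at h
  refine h.congr fun y => ?_
  rw [Lp.edist_def]
  refine eLpNorm_congr_ae ?_
  have e1 := Lp.coeFn_compMeasurePreserving (hf.toLp f) (hmp y)
  have e2 := Lp.coeFn_compMeasurePreserving (hf.toLp f) (hmp 0)
  have e3 := (hmp y).quasiMeasurePreserving.ae_eq hf.coeFn_toLp
  have e4 := (hmp 0).quasiMeasurePreserving.ae_eq hf.coeFn_toLp
  filter_upwards [e1, e2, e3, e4] with x h1 h2 h3 h4
  simp only [Function.comp, sub_zero] at h1 h2 h3 h4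
  change (Lp.compMeasurePreserving (fun x => x - y) (hmp y) (hf.toLp f)) x -
    (Lp.compMeasurePreserving (fun x => x - 0) (hmp 0) (hf.toLp f)) x = _
  simp only [sub_zero] at *
  rw [h1, h2, h3, h4]

section Mollify

variable {F : Type*} [NormedAddCommGroup F] [NormedSpace ℝ F]

theorem IsMollifier.integrable {k : E n → ℝ} (hk : IsMollifier k) : Integrable k :=
  hk.contDiff.continuous.integrable_of_hasCompactSupport hk.hasCompactSupport

/-- The convolution of `f` with the scalar kernel `k`. -/
noncomputable def mollify (k : E n → ℝ) (f : E n → F) : E n → F :=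
  k ⋆[ContinuousLinearMap.lsmul ℝ ℝ, volume] f

theorem mollify_apply (k : E n → ℝ) (f : E n → F) (x : E n) :
    mollify k f x = ∫ y, k y • f (x - y) := rfl

theorem mollify_apply_swap (k : E n → ℝ) (f : E n → F) (x : E n) :
    mollify k f x = ∫ y, k (x - y) • f y := by
  rw [mollify, convolution_eq_swap]; rfl

theorem IsMollifier.contDiff_mollify {k : E n → ℝ} (hk : IsMollifier k) {f : E n → F}
    (hf : LocallyIntegrable f) : ContDiff ℝ ∞ (mollify k f) :=
  hk.hasCompactSupport.contDiff_convolution_left _ hk.contDiff hf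

theorem IsMollifier.integrable_smul {k : E n → ℝ} (hk : IsMollifier k) {f : E n → F}
    (hf : LocallyIntegrable f) (x : E n) : Integrable fun y => k y • f (x - y) :=
  hk.hasCompactSupport.convolutionExists_left (ContinuousLinearMap.lsmul ℝ ℝ)
    hk.contDiff.continuous hf x

theorem IsMollifier.mollify_sub {k : E n → ℝ} (hk : IsMollifier k) [CompleteSpace F] {f : E n → F}
    (hf : LocallyIntegrable f) (x : E n) (c : F) :
    mollify k f x - c = ∫ y, k y • (f (x - y) - c) := by
  simp_rw [smul_sub]
  rw [integral_sub (hk.integrable_smul hf x) (hk.integrable.smul_const c), integral_smul_const,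
    hk.integral_eq_one, one_smul, mollify_apply]

/-- Only the values of `f` on `x - support k` matter. With `δ = 0` this computes the mollification
wherever `f` is constant on that set. -/
theorem IsMollifier.norm_mollify_sub_le {k : E n → ℝ} (hk : IsMollifier k) [CompleteSpace F]
    {f : E n → F} (hf : LocallyIntegrable f) {x : E n} {c : F} {δ : ℝ}
    (h : ∀ y ∈ Function.support k, ‖f (x - y) - c‖ ≤ δ) : ‖mollify k f x - c‖ ≤ δ := by
  rw [hk.mollify_sub hf]
  calc ‖∫ y, k y • (f (x - y) - c)‖ ≤ ∫ y, k y * δ := by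
        refine norm_integral_le_of_norm_le (hk.integrable.mul_const δ) (.of_forall fun y => ?_)
        rw [norm_smul, Real.norm_of_nonneg (hk.nonneg y)]
        by_cases hy : k y = 0
        · simp [hy]
        · exact mul_le_mul_of_nonneg_left (h y hy) (hk.nonneg y)
    _ = δ := by rw [integral_mul_const, hk.integral_eq_one, one_mul]

theorem IsMollifier.lipschitzWith_mollify {k : E n → ℝ} (hk : IsMollifier k) [CompleteSpace F]
    {f : E n → F} {K : ℝ≥0} (hf : LipschitzWith K f) : LipschitzWith K (mollify k f) := by
  refine LipschitzWith.of_dist_le_mul fun x y => ?_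
  have hl := hf.continuous.locallyIntegrable (μ := (volume : Measure (E n)))
  rw [dist_eq_norm, hk.mollify_sub hl x]
  have : ∫ z, k z • (f (x - z) - mollify k f y) = ∫ z, k z • (f (x - z) - f (y - z)) := by
    simp_rw [smul_sub]
    rw [integral_sub (hk.integrable_smul hl x) (hk.integrable.smul_const _),
      integral_sub (hk.integrable_smul hl x) (hk.integrable_smul hl y), integral_smul_const,
      hk.integral_eq_one, one_smul, mollify_apply]
  rw [this]
  calc ‖∫ z, k z • (f (x - z) - f (y - z))‖ ≤ ∫ z, k z * (K * dist x y) := by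
        refine norm_integral_le_of_norm_le (hk.integrable.mul_const _) (.of_forall fun z => ?_)
        rw [norm_smul, Real.norm_of_nonneg (hk.nonneg z), ← dist_eq_norm]
        refine mul_le_mul_of_nonneg_left ((hf.dist_le_mul _ _).trans ?_) (hk.nonneg z)
        simp
    _ = K * dist x y := by rw [integral_mul_const, hk.integral_eq_one, one_mul]

/-- Jensen's inequality for the power function. -/
theorem lintegral_rpow_le_of_isProbabilityMeasure {α : Type*} [MeasurableSpace α] (ν : Measure α)
    [IsProbabilityMeasure ν] {p : ℝ} (hp : 1 ≤ p) {f : α → ℝ≥0∞} (hf : AEMeasurable f ν) :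
    (∫⁻ a, f a ∂ν) ^ p ≤ ∫⁻ a, f a ^ p ∂ν := by
  have h := eLpNorm'_le_eLpNorm'_of_exponent_le one_pos hp ν hf.aestronglyMeasurable
  simp only [eLpNorm', enorm_eq_self, ENNReal.rpow_one, div_one] at h
  have hp0 : 0 < p := by linarith
  rwa [one_div, ENNReal.le_rpow_inv_iff hp0] at h

/-- Jensen's inequality for the probability measure of density `k`. -/
theorem IsMollifier.enorm_mollify_sub_rpow_le {k : E n → ℝ} (hk : IsMollifier k) [CompleteSpace F]
    {f : E n → F} (hf : LocallyIntegrable f) (hfm : StronglyMeasurable f) {p : ℝ} (hp : 1 ≤ p)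
    (x : E n) (c : F) :
    ‖mollify k f x - c‖ₑ ^ p ≤ ∫⁻ y, ENNReal.ofReal (k y) * ‖f (x - y) - c‖ₑ ^ p := by
  have hkm : Measurable fun y => ENNReal.ofReal (k y) := hk.contDiff.continuous.measurable.ennreal_ofReal
  set ν : Measure (E n) := volume.withDensity fun y => ENNReal.ofReal (k y) with hν
  have : IsProbabilityMeasure ν := ⟨by
    rw [hν, withDensity_apply _ MeasurableSet.univ, setLIntegral_univ,
      ← ofReal_integral_eq_lintegral_ofReal hk.integrable (.of_forall hk.nonneg),
      hk.integral_eq_one, ENNReal.ofReal_one]⟩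
  have hm : Measurable fun y => ‖f (x - y) - c‖ₑ :=
    ((hfm.comp_measurable (measurable_const.sub measurable_id)).sub stronglyMeasurable_const).enorm
  have h1 : ‖mollify k f x - c‖ₑ ≤ ∫⁻ y, ‖f (x - y) - c‖ₑ ∂ν := by
    rw [hk.mollify_sub hf, hν, lintegral_withDensity_eq_lintegral_mul _ hkm hm]
    refine (enorm_integral_le_lintegral_enorm _).trans_eq (lintegral_congr fun y => ?_)
    simp [enorm_smul, Real.enorm_of_nonneg (hk.nonneg y)]
  calc _ ≤ (∫⁻ y, ‖f (x - y) - c‖ₑ ∂ν) ^ p := by gcongr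
    _ ≤ ∫⁻ y, ‖f (x - y) - c‖ₑ ^ p ∂ν :=
      lintegral_rpow_le_of_isProbabilityMeasure ν hp hm.aemeasurable
    _ = _ := by
      rw [hν, lintegral_withDensity_eq_lintegral_mul _ hkm (hm.pow_const p)]; rfl

/-- Integrate the pointwise Jensen bound in `x` and exchange the integrals: the mollification error
is an average of translation errors. -/
theorem IsMollifier.eLpNorm_mollify_sub_le {k : E n → ℝ} (hk : IsMollifier k) [CompleteSpace F]
    {f : E n → F} {p : ℝ≥0∞} (hp : 1 ≤ p) (hp' : p ≠ ⊤) (hf : MemLp f p) {δ : ℝ≥0∞}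
    (h : ∀ y ∈ Function.support k, eLpNorm (fun x => f (x - y) - f x) p ≤ δ) :
    eLpNorm (fun x => mollify k f x - f x) p ≤ δ := by
  -- Tonelli needs `f (x - y) - f x` to be jointly measurable, so `f` is first replaced by a
  -- strongly measurable representative.
  wlog hfm : StronglyMeasurable f generalizing f
  · have he := hf.1.ae_eq_mk
    have h2 : mollify k f = mollify k (hf.1.mk f) := by
      ext x
      rw [mollify, mollify]
      exact congrFun (convolution_congr _ (ae_eq_refl k) he) x
    rw [eLpNorm_congr_ae (g := fun x => mollify k (hf.1.mk f) x - hf.1.mk f x)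
      (by filter_upwards [he] with x hx; rw [hx, h2])]
    refine this (hf.ae_eq he) (fun y hy => ?_) hf.1.stronglyMeasurable_mk
    refine le_trans (le_of_eq (eLpNorm_congr_ae ?_)) (h y hy)
    have := (measurePreserving_sub_right (volume : Measure (E n)) y).quasiMeasurePreserving.ae_eq he
    filter_upwards [he, this] with x hx hx'
    simp only [Function.comp] at hx'
    rw [hx, hx']
  have hloc : LocallyIntegrable f := hf.locallyIntegrable hp
  have hp0 : p ≠ 0 := (zero_lt_one.trans_le hp).ne'
  have hpr : 1 ≤ p.toReal := by
    rw [← ENNReal.toReal_one]; exact (ENNReal.toReal_le_toReal (by simp) hp').2 hp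
  have hpos : 0 < p.toReal := by linarith
  have hkm : Measurable fun y => ENNReal.ofReal (k y) := hk.contDiff.continuous.measurable.ennreal_ofReal
  have key : ∀ g : E n → F, eLpNorm g p ≤ δ ↔ ∫⁻ x, ‖g x‖ₑ ^ p.toReal ≤ δ ^ p.toReal := fun g => by
    rw [eLpNorm_eq_lintegral_rpow_enorm_toReal hp0 hp', one_div, ENNReal.rpow_inv_le_iff hpos]
  rw [key]
  calc ∫⁻ x, ‖mollify k f x - f x‖ₑ ^ p.toReal
      ≤ ∫⁻ x, ∫⁻ y, ENNReal.ofReal (k y) * ‖f (x - y) - f x‖ₑ ^ p.toReal :=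
        lintegral_mono fun x => hk.enorm_mollify_sub_rpow_le hloc hfm hpr x _
    _ = ∫⁻ y, ∫⁻ x, ENNReal.ofReal (k y) * ‖f (x - y) - f x‖ₑ ^ p.toReal := by
        refine lintegral_lintegral_swap (Measurable.aemeasurable ?_)
        refine (hkm.comp measurable_snd).mul (Measurable.pow_const ?_ _)
        exact ((hfm.comp_measurable (measurable_fst.sub measurable_snd)).sub
          (hfm.comp_measurable measurable_fst)).enorm
    _ ≤ ∫⁻ y, ENNReal.ofReal (k y) * δ ^ p.toReal := by
        refine lintegral_mono fun y => ?_
        simp only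
        rw [lintegral_const_mul' _ _ ENNReal.ofReal_ne_top]
        by_cases hy : k y = 0
        · simp [hy]
        · gcongr
          exact (key _).1 (h y hy)
    _ = δ ^ p.toReal := by
        rw [lintegral_mul_const _ hkm,
          ← ofReal_integral_eq_lintegral_ofReal hk.integrable (.of_forall hk.nonneg),
          hk.integral_eq_one, ENNReal.ofReal_one, one_mul]

end Mollify


/-! ### Graph charts -/

/-- Near `x₀`, the set `Ω` is `{h > 0}`, where `h` is Lipschitz and decreases with unit speed in the
unit direction `e`: it is the height of the graph above a point. -/
structure IsGraphChart (Ω : Set (E n)) (x₀ e : E n) (L : ℝ≥0) (h : E n → ℝ) (R : ℝ) : Prop where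
  norm_eq_one : ‖e‖ = 1
  lipschitz : LipschitzWith L h
  map_add_smul : ∀ x t, h (x + t • e) = h x - t
  radius_pos : 0 < R
  mem_iff : ∀ x ∈ Metric.ball x₀ R, x ∈ Ω ↔ 0 < h x

theorem IsLipschitzDomain.exists_isGraphChart {Ω : Set (E n)} (hΩ : IsLipschitzDomain Ω)
    {x₀ : E n} (hx₀ : x₀ ∈ frontier Ω) :
    ∃ (e : E n) (L : ℝ≥0) (h : E n → ℝ) (R : ℝ), IsGraphChart Ω x₀ e L h R := by
  obtain ⟨e, he, K, γ, hγ, U, hU, hmem⟩ := hΩ.2.2 x₀ hx₀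
  obtain ⟨R, hR, hball⟩ := Metric.mem_nhds_iff.1 hU
  refine ⟨e, K + 1, fun x => γ ((ℝ ∙ e)ᗮ.orthogonalProjectionOnto x) - ⟪e, x⟫, R, he, ?_, ?_, hR, ?_⟩
  · refine LipschitzWith.sub ?_ ?_
    · have := hγ.comp ((ℝ ∙ e)ᗮ.lipschitzWith_orthogonalProjectionOnto)
      rw [mul_one] at this
      exact this
    · refine LipschitzWith.of_dist_le_mul fun x y => ?_
      rw [Real.dist_eq, ← inner_sub_right, NNReal.coe_one, one_mul, dist_eq_norm]
      simpa [he] using abs_real_inner_le_norm e (x - y)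
  · intro x t
    have h1 : (ℝ ∙ e)ᗮ.orthogonalProjectionOnto (t • e) = 0 := by
      rw [Submodule.orthogonalProjectionOnto_eq_zero_iff, Submodule.orthogonal_orthogonal]
      exact Submodule.smul_mem _ _ (Submodule.mem_span_singleton_self e)
    simp only [map_add, h1, add_zero, inner_add_right, inner_smul_right,
      real_inner_self_eq_norm_sq, he]
    ring
  · intro x hx
    rw [hmem x (hball hx), sub_pos]

namespace IsGraphChart

variable {Ω : Set (E n)} {x₀ e : E n} {L : ℝ≥0} {h : E n → ℝ} {R : ℝ}

theorem le_map_add (hc : IsGraphChart Ω x₀ e L h R) (x y : E n) : h x - L * dist x y ≤ h y := by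
  have := (abs_le.1 (hc.lipschitz.dist_le_mul x y)).2
  linarith

theorem nonneg_of_mem_closure (hc : IsGraphChart Ω x₀ e L h R) {x : E n}
    (hx : x ∈ Metric.ball x₀ R) (hxΩ : x ∈ closure Ω) : 0 ≤ h x := by
  have h1 : x ∈ closure (Metric.ball x₀ R ∩ Ω) := Metric.isOpen_ball.inter_closure ⟨hx, hxΩ⟩
  have h2 : IsClosed {x | 0 ≤ h x} := isClosed_le continuous_const hc.lipschitz.continuous
  exact closure_minimal (fun y hy => ((hc.mem_iff y hy.1).1 hy.2).le) h2 h1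

theorem mem_frontier_iff (hc : IsGraphChart Ω x₀ e L h R) (hΩ : IsOpen Ω) {x : E n}
    (hx : x ∈ Metric.ball x₀ R) : x ∈ frontier Ω ↔ h x = 0 := by
  rw [hΩ.frontier_eq]
  refine ⟨fun hf => le_antisymm ?_ (hc.nonneg_of_mem_closure hx hf.1), fun h0 => ⟨?_, ?_⟩⟩
  · by_contra! hpos
    exact hf.2 ((hc.mem_iff x hx).2 hpos)
  -- Moving against `e` raises `h`, so a point of the graph is a limit of points of `Ω`.
  · have hcont : Continuous fun t : ℝ => x + (-t) • e := by fun_prop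
    have ht : Tendsto (fun t : ℝ => x + (-t) • e) (𝓝[>] 0) (𝓝 x) := by
      simpa using (hcont.tendsto 0).mono_left nhdsWithin_le_nhds
    refine mem_closure_of_tendsto ht ?_
    filter_upwards [ht (Metric.isOpen_ball.mem_nhds hx), self_mem_nhdsWithin] with t h1 h2
    rw [hc.mem_iff _ h1, hc.map_add_smul, h0]
    simpa using h2
  · rw [hc.mem_iff x hx, h0]
    exact lt_irrefl 0

end IsGraphChart

/-- Points of `closure Ω` can be pushed into `Ω`, in a direction that is locally constant. -/
theorem IsLipschitzDomain.exists_inward_direction {Ω : Set (E n)} (hΩ : IsLipschitzDomain Ω)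
    {x₀ : E n} (hx₀ : x₀ ∈ closure Ω) :
    ∃ w : E n, ∃ U : Set (E n), IsOpen U ∧ x₀ ∈ U ∧ ∃ ε₀ > 0, ∀ ε : ℝ, 0 < ε → ε < ε₀ →
      ∀ x ∈ closure Ω ∩ U, Metric.closedBall (x - ε • w) ε ⊆ Ω := by
  by_cases h : x₀ ∈ Ω
  · obtain ⟨r, hr, hb⟩ := Metric.isOpen_iff.1 hΩ.1 x₀ h
    refine ⟨0, Metric.ball x₀ (r / 2), Metric.isOpen_ball, Metric.mem_ball_self (by positivity),
      r / 2, by positivity, fun ε _ hε x hx y hy => hb ?_⟩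
    have h1 := hx.2
    rw [smul_zero, sub_zero] at hy
    rw [Metric.mem_ball] at h1 ⊢
    rw [Metric.mem_closedBall] at hy
    linarith [dist_triangle y x x₀]
  · have hf : x₀ ∈ frontier Ω := by rw [hΩ.1.frontier_eq]; exact ⟨hx₀, h⟩
    obtain ⟨e, L, h, R, hc⟩ := hΩ.exists_isGraphChart hf
    have hR := hc.radius_pos
    have hL : (0 : ℝ) ≤ L := L.2
    -- The shift raises `h` by `ε (L + 1)`, and a ball of radius `ε` loses at most `ε L` of this.
    -- The total displacement `ε (L + 2)` must stay below `R / 2` to remain in the chart, hence the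
    -- bound on `ε`.
    refine ⟨((L : ℝ) + 1) • e, Metric.ball x₀ (R / 2), Metric.isOpen_ball,
      Metric.mem_ball_self (by positivity), R / 2 / (L + 2), by positivity,
      fun ε hε0 hε x hx y hy => ?_⟩
    rw [lt_div_iff₀ (by positivity)] at hε
    rw [Metric.mem_closedBall'] at hy
    have h1 := hx.2
    rw [Metric.mem_ball] at h1
    have h3 : dist (x - ε • ((L : ℝ) + 1) • e) x = ε * (L + 1) := by
      rw [dist_eq_norm, sub_sub_cancel_left, norm_neg, norm_smul, norm_smul, hc.norm_eq_one,
        Real.norm_of_nonneg hε0.le, Real.norm_of_nonneg (by positivity), mul_one]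
    have h4 : y ∈ Metric.ball x₀ R := by
      rw [Metric.mem_ball]
      have h8 := dist_triangle4 y (x - ε • ((L : ℝ) + 1) • e) x x₀
      rw [dist_comm y (x - _)] at h8
      linarith
    rw [hc.mem_iff y h4]
    have h5 := hc.le_map_add (x - ε • ((L : ℝ) + 1) • e) y
    have h6 : h (x - ε • ((L : ℝ) + 1) • e) = h x + ε * (L + 1) := by
      have := hc.map_add_smul x (-(ε * (L + 1)))
      rw [neg_smul, ← sub_eq_add_neg, mul_smul] at this
      rw [this]; ring
    have h7 := hc.nonneg_of_mem_closure (Metric.ball_subset_ball (by linarith) hx.2) hx.1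
    nlinarith [mul_le_mul_of_nonneg_left hy hL]

/-! ### Mollification of weakly differentiable functions -/

theorem inner_gradient {f : E n → ℝ} (x v : E n) : ⟪gradient f x, v⟫ = fderiv ℝ f x v := by
  simp [gradient]

theorem norm_gradient (f : E n → ℝ) (x : E n) : ‖gradient f x‖ = ‖fderiv ℝ f x‖ := by
  simp [gradient]

theorem IsMollifier.fderiv_mollify {k : E n → ℝ} (hk : IsMollifier k) {f : E n → ℝ}
    (hf : LocallyIntegrable f) (x v : E n) :
    fderiv ℝ (mollify k f) x v = ∫ y, f y * fderiv ℝ k (x - y) v := by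
  have h1 : ContDiff ℝ 1 k := hk.contDiff.of_le (by norm_cast)
  have hd := hk.hasCompactSupport.hasFDerivAt_convolution_left
    (ContinuousLinearMap.lsmul ℝ ℝ) h1 hf x
  rw [show fderiv ℝ (mollify k f) x = _ from hd.fderiv, convolution_eq_swap]
  have hint := (hk.hasCompactSupport.fderiv ℝ).convolutionExists_left
    (ContinuousLinearMap.precompL (E n) (ContinuousLinearMap.lsmul ℝ ℝ))
    (h1.continuous_fderiv one_ne_zero) hf x
  rw [ContinuousLinearMap.integral_apply]
  · refine integral_congr_ae (.of_forall fun y => ?_)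
    simp [ContinuousLinearMap.precompL, mul_comm]
  · exact hint.integrable_swap

/-- When `x - tsupport k` lies in `Ω`, the function `y ↦ k (x - y)` is a test function, and the weak
gradient is tested against it. The jump of the zero extension across `∂Ω` is then never seen. -/
theorem IsWeakGradient.gradient_mollify {Ω : Set (E n)} (hΩ : MeasurableSet Ω) {u : E n → ℝ}
    {G : E n → E n} (hG : IsWeakGradient Ω u G) (hu : LocallyIntegrable (Ω.indicator u))
    (hGl : LocallyIntegrable (Ω.indicator G)) {k : E n → ℝ} (hk : IsMollifier k) {x : E n}
    (hx : ∀ y ∈ tsupport k, x - y ∈ Ω) :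
    gradient (mollify k (Ω.indicator u)) x = mollify k (Ω.indicator G) x := by
  refine ext_inner_right ℝ fun v => ?_
  rw [inner_gradient, hk.fderiv_mollify hu, mollify_apply_swap]
  set ψ : E n → ℝ := fun y => k (x - y) with hψ
  have hψt : IsTestFunction Ω ψ := by
    refine ⟨hk.contDiff.comp (contDiff_const.sub contDiff_id),
      hk.hasCompactSupport.comp_homeomorph (Homeomorph.subLeft x), fun y hy => ?_⟩
    have h1 : x - y ∈ tsupport k :=
      tsupport_comp_subset_preimage k (f := fun y => x - y) (by fun_prop) hy
    simpa using hx _ h1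
  have h1 : ∀ y, fderiv ℝ ψ y v = - fderiv ℝ k (x - y) v := fun y => by
    have hd : DifferentiableAt ℝ k (x - y) := (hk.contDiff.differentiable (by simp)) _
    have h2 : HasFDerivAt ψ _ y := hd.hasFDerivAt.comp y ((hasFDerivAt_id y).const_sub x)
    rw [h2.fderiv]
    simp
  have h2 := hG ψ hψt v
  have h3 : ∫ y, Ω.indicator u y * fderiv ℝ k (x - y) v = - ∫ y in Ω, u y * fderiv ℝ ψ y v := by
    rw [← integral_indicator hΩ, ← integral_neg]
    refine integral_congr_ae (.of_forall fun y => ?_)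
    by_cases hy : y ∈ Ω <;> simp [hy, h1]
  rw [h3, h2, neg_neg, real_inner_comm, ← integral_indicator hΩ]
  have hint : Integrable fun y => k (x - y) • Ω.indicator G y :=
    ConvolutionExistsAt.integrable_swap (L := ContinuousLinearMap.lsmul ℝ ℝ)
      (hk.hasCompactSupport.convolutionExists_left (ContinuousLinearMap.lsmul ℝ ℝ)
        hk.contDiff.continuous hGl x)
  rw [← integral_inner hint]
  refine integral_congr_ae (.of_forall fun y => ?_)
  by_cases hy : y ∈ Ω <;> simp [hy, inner_smul_right, real_inner_comm, hψ, mul_comm]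


/-! ### Density of smooth functions -/

theorem tendsto_eLpNorm_mollify_sub {F : Type*} [NormedAddCommGroup F] [NormedSpace ℝ F]
    [CompleteSpace F] {f : E n → F} {p : ℝ≥0∞} (hp : 1 ≤ p) (hp' : p ≠ ⊤) (hf : MemLp f p)
    {k : ℕ → E n → ℝ} (hk : ∀ m, IsMollifier (k m)) {r : ℕ → ℝ} (hr : Tendsto r atTop (𝓝 0))
    (hkr : ∀ m, ∀ y ∈ tsupport (k m), ‖y‖ ≤ r m) :
    Tendsto (fun m => eLpNorm (fun x => mollify (k m) f x - f x) p) atTop (𝓝 0) := by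
  rw [ENNReal.tendsto_nhds_zero]
  intro δ hδ
  have h := (ENNReal.tendsto_nhds_zero.1 (tendsto_eLpNorm_translate_sub hp hp' hf)) δ hδ
  obtain ⟨η, hη, hball⟩ := Metric.eventually_nhds_iff.1 h
  filter_upwards [hr.eventually (gt_mem_nhds hη)] with m hm
  refine (hk m).eLpNorm_mollify_sub_le hp hp' hf fun y hy => hball ?_
  rw [dist_zero_right]
  exact (hkr m y (subset_tsupport _ hy)).trans_lt hm

theorem gradient_sum_mul {ι : Type*} [Fintype ι] {θ v : ι → E n → ℝ}
    (hθ : ∀ i, ContDiff ℝ ∞ (θ i)) (hv : ∀ i, ContDiff ℝ ∞ (v i)) (x : E n) :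
    gradient (fun x => ∑ i, θ i x * v i x) x =
      ∑ i, (θ i x • gradient (v i) x + v i x • gradient (θ i) x) := by
  refine ext_inner_right ℝ fun w => ?_
  have h : HasFDerivAt (fun x => ∑ i, θ i x * v i x)
      (∑ i, (θ i x • fderiv ℝ (v i) x + v i x • fderiv ℝ (θ i) x)) x :=
    HasFDerivAt.fun_sum fun i _ =>
      ((hθ i).differentiable (by simp) x).hasFDerivAt.mul
        ((hv i).differentiable (by simp) x).hasFDerivAt
  rw [inner_gradient, h.fderiv, sum_inner]
  simp [inner_add_left, inner_smul_left]

/-- A finite smooth partition of unity on a compact set, subordinate to given neighbourhoods. -/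
theorem exists_finite_partition {K : Set (E n)} (hK : IsCompact K) {U : K → Set (E n)}
    (hU : ∀ x, IsOpen (U x)) (hxU : ∀ x : K, (x : E n) ∈ U x) :
    ∃ (t : Finset K) (θ : t → E n → ℝ), (∀ i, ContDiff ℝ ∞ (θ i)) ∧ (∀ i x, 0 ≤ θ i x) ∧
      (∀ x ∈ K, ∑ i, θ i x = 1) ∧ ∀ i x, θ i x ≠ 0 → x ∈ U i := by
  obtain ⟨t, ht⟩ := hK.elim_finite_subcover U hU fun x hx => Set.mem_iUnion.2 ⟨⟨x, hx⟩, hxU ⟨x, hx⟩⟩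
  obtain ⟨f, hf⟩ := SmoothPartitionOfUnity.exists_isSubordinate (modelWithCornersSelf ℝ (E n))
    hK.isClosed (fun i : t => U i) (fun i => hU i) (fun x hx => by
      obtain ⟨i, hi, hxi⟩ := Set.mem_iUnion₂.1 (ht hx)
      exact Set.mem_iUnion.2 ⟨⟨i, hi⟩, hxi⟩)
  refine ⟨t, fun i => f i, fun i => (f i).contMDiff.contDiff, fun i x => f.nonneg i x,
    fun x hx => ?_, fun i x hx => hf i (subset_tsupport _ hx)⟩
  rw [← f.sum_eq_one hx, finsum_eq_sum_of_fintype]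

/-- In each patch `U i` the kernel lives in the ball of centre `ε • w i` and radius `ε`, so
mollifying at points of `closure Ω ∩ U i` samples `Ω` only. One sequence serves both the Sobolev and
the uniform convergence. -/
theorem IsLipschitzDomain.exists_smooth_approx {Ω : Set (E n)} (hΩ : IsLipschitzDomain Ω)
    {p : ℝ≥0∞} (hp : 1 ≤ p) (hp' : p ≠ ⊤) {u : E n → ℝ} {G : E n → E n}
    (hu : MemLp u p (volume.restrict Ω)) (hGp : MemLp G p (volume.restrict Ω))
    (hG : IsWeakGradient Ω u G) :
    ∃ φ : ℕ → E n → ℝ, (∀ m, ContDiff ℝ ∞ (φ m)) ∧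
      Tendsto (fun m => eLpNorm (fun x => φ m x - u x) p (volume.restrict Ω)) atTop (𝓝 0) ∧
      Tendsto (fun m => eLpNorm (fun x => gradient (φ m) x - G x) p (volume.restrict Ω))
        atTop (𝓝 0) ∧
      (ContinuousOn u (closure Ω) → TendstoUniformlyOn φ u atTop (closure Ω)) := by
  have hΩm : MeasurableSet Ω := hΩ.1.measurableSet
  have hcpt : IsCompact (closure Ω) := hΩ.2.1.isCompact_closure
  have hchart := fun x : closure Ω => hΩ.exists_inward_direction x.2
  choose w U hUo hxU ε₀ hε₀ hin using hchart
  obtain ⟨t, θ, hθs, hθ0, hθ1, hθU⟩ := exists_finite_partition hcpt hUo hxU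
  set ε : ℕ → ℝ := fun m => 1 / (2 * ((m : ℝ) + 1)) with hε
  have hεpos : ∀ m, 0 < ε m := fun m => by positivity
  have hεlim : Tendsto ε atTop (𝓝 0) := by
    have := (tendsto_one_div_add_atTop_nhds_zero_nat (𝕜 := ℝ)).const_mul (1 / 2)
    rw [mul_zero] at this
    refine this.congr fun m => ?_
    simp only [hε]; field_simp
  choose k hk hksupp using fun (i : t) (m : ℕ) =>
    exists_isMollifier (ε m • w i) (hεpos m)
  have hkt : ∀ i m, tsupport (k i m) ⊆ Metric.closedBall (ε m • w i) (ε m) := fun i m =>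
    closure_minimal ((hksupp i m).trans Metric.ball_subset_closedBall) Metric.isClosed_closedBall
  have hknorm : ∀ i m, ∀ y ∈ tsupport (k i m), ‖y‖ ≤ ε m * (‖w i‖ + 1) := fun i m y hy => by
    have h1 := hkt i m hy
    rw [Metric.mem_closedBall, dist_eq_norm] at h1
    have h2 := norm_add_le (y - ε m • w i) (ε m • w i)
    rw [sub_add_cancel, norm_smul, Real.norm_of_nonneg (hεpos m).le] at h2
    linarith
  have hrlim : ∀ i : t, Tendsto (fun m => ε m * (‖w i‖ + 1)) atTop (𝓝 0) := fun i => by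
    simpa using hεlim.mul_const (‖w i‖ + 1)
  have hkin : ∀ᶠ m in atTop, ∀ i : t, ∀ x ∈ closure Ω ∩ U i, ∀ y ∈ tsupport (k i m), x - y ∈ Ω := by
    refine eventually_all.2 fun i => ?_
    filter_upwards [hεlim.eventually (gt_mem_nhds (hε₀ i))] with m hm x hx y hy
    refine hin i (ε m) (hεpos m) hm x hx ?_
    have h1 := hkt i m hy
    rw [Metric.mem_closedBall, dist_eq_norm] at h1 ⊢
    rwa [sub_sub_sub_cancel_left, norm_sub_rev]
  have hub : MemLp (Ω.indicator u) p := (memLp_indicator_iff_restrict hΩm).2 hu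
  have hGb : MemLp (Ω.indicator G) p := (memLp_indicator_iff_restrict hΩm).2 hGp
  have hul := hub.locallyIntegrable hp
  have hGl := hGb.locallyIntegrable hp
  set v : t → ℕ → E n → ℝ := fun i m => mollify (k i m) (Ω.indicator u) with hv
  have hvs : ∀ i m, ContDiff ℝ ∞ (v i m) := fun i m => (hk i m).contDiff_mollify hul
  have hvlim : ∀ i, Tendsto (fun m => eLpNorm (fun x => v i m x - Ω.indicator u x) p) atTop (𝓝 0) :=
    fun i => tendsto_eLpNorm_mollify_sub hp hp' hub (hk i) (hrlim i) (hknorm i)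
  have hVlim : ∀ i, Tendsto (fun m => eLpNorm (fun x => mollify (k i m) (Ω.indicator G) x -
      Ω.indicator G x) p) atTop (𝓝 0) :=
    fun i => tendsto_eLpNorm_mollify_sub hp hp' hGb (hk i) (hrlim i) (hknorm i)
  have hθle : ∀ i, ∀ x ∈ closure Ω, θ i x ≤ 1 := fun i x hx => by
    rw [← hθ1 x hx]
    exact Finset.single_le_sum (f := fun i => θ i x) (fun j _ => hθ0 j x) (Finset.mem_univ i)
  have hC : ∀ i, ∃ C : ℝ, ∀ x ∈ closure Ω, ‖gradient (θ i) x‖ ≤ C := fun i => by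
    simp_rw [norm_gradient]
    exact hcpt.exists_bound_of_continuousOn
      ((hθs i).continuous_fderiv (by simp)).continuousOn
  choose C hC using hC
  -- This lets `u` be subtracted for free: `∑ v i ∇θ i = ∑ (v i - u) ∇θ i`, which is small in `L^p`.
  have hgradsum : ∀ x ∈ Ω, ∑ i, gradient (θ i) x = 0 := fun x hx => by
    have h1 := gradient_sum_mul hθs (v := fun _ _ => 1) (fun _ => contDiff_const) x
    have h2 : gradient (fun x => ∑ i, θ i x * 1) x = 0 := by
      have : (fun x => ∑ i, θ i x * 1) =ᶠ[𝓝 x] fun _ => (1 : ℝ) := by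
        filter_upwards [hΩ.1.mem_nhds hx] with y hy
        simpa using hθ1 y (subset_closure hy)
      rw [gradient, this.fderiv_eq]; simp
    have h3 : gradient (fun _ : E n => (1 : ℝ)) x = 0 := by simp [gradient]
    rw [h2] at h1
    simpa [h3] using h1.symm
  have hsm : ∀ f : ℕ → t → E n → ℝ, (∀ m i, AEStronglyMeasurable (f m i) volume) →
      (∀ i, Tendsto (fun m => eLpNorm (f m i) p) atTop (𝓝 0)) →
      Tendsto (fun m => eLpNorm (∑ i, f m i) p (volume.restrict Ω)) atTop (𝓝 0) := by
    intro f hfm hf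
    have : Tendsto (fun m => ∑ i, eLpNorm (f m i) p) atTop (𝓝 0) := by
      simpa using tendsto_finsetSum Finset.univ fun i _ => hf i
    refine tendsto_of_tendsto_of_tendsto_of_le_of_le tendsto_const_nhds this
      (fun _ => zero_le) fun m => ?_
    exact (eLpNorm_mono_measure _ Measure.restrict_le_self).trans
      (eLpNorm_sum_le (fun i _ => hfm m i) hp)
  have hvm : ∀ i m, AEStronglyMeasurable (fun x => v i m x - Ω.indicator u x) volume := fun i m =>
    (hvs i m).continuous.aestronglyMeasurable.sub hub.1
  have hVm : ∀ i m, AEStronglyMeasurable (fun x => mollify (k i m) (Ω.indicator G) x -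
      Ω.indicator G x) volume := fun i m =>
    ((hk i m).contDiff_mollify hGl).continuous.aestronglyMeasurable.sub hGb.1
  refine ⟨fun m x => ∑ i, θ i x * v i m x, fun m => ContDiff.sum fun i _ => (hθs i).mul (hvs i m),
    ?_, ?_, fun hcont => ?_⟩
  · refine tendsto_of_tendsto_of_tendsto_of_le_of_le tendsto_const_nhds
      (hsm (fun m i x => ‖v i m x - Ω.indicator u x‖) (fun m i => (hvm i m).norm)
        fun i => by simpa only [eLpNorm_norm] using hvlim i) (fun _ => zero_le) fun m => ?_
    refine eLpNorm_mono_ae_real ((ae_restrict_iff' hΩm).2 (.of_forall fun x hx => ?_))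
    have h1 : ∑ i, θ i x * v i m x - u x = ∑ i, θ i x * (v i m x - Ω.indicator u x) := by
      simp_rw [mul_sub, Finset.sum_sub_distrib, ← Finset.sum_mul, hθ1 x (subset_closure hx),
        Set.indicator_of_mem hx, one_mul]
    rw [h1, Finset.sum_apply]
    refine (norm_sum_le _ _).trans (Finset.sum_le_sum fun i _ => ?_)
    rw [norm_mul, Real.norm_of_nonneg (hθ0 i x)]
    exact mul_le_of_le_one_left (norm_nonneg _) (hθle i x (subset_closure hx))
  · refine tendsto_of_tendsto_of_tendsto_of_le_of_le' tendsto_const_nhds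
      (hsm (fun m i x => ‖mollify (k i m) (Ω.indicator G) x - Ω.indicator G x‖ +
          C i * ‖v i m x - Ω.indicator u x‖)
        (fun m i => (hVm i m).norm.add ((hvm i m).norm.const_mul _)) fun i => ?_)
      (.of_forall fun _ => zero_le) ?_
    · have h1 : Tendsto (fun m => eLpNorm (fun x => mollify (k i m) (Ω.indicator G) x -
          Ω.indicator G x) p + ‖C i‖ₑ * eLpNorm (fun x => v i m x - Ω.indicator u x) p)
          atTop (𝓝 0) := by
        have := (hVlim i).add (ENNReal.Tendsto.const_mul (a := ‖C i‖ₑ) (hvlim i) (Or.inr (by simp)))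
        simpa using this
      refine tendsto_of_tendsto_of_tendsto_of_le_of_le tendsto_const_nhds h1
        (fun _ => zero_le) fun m => ?_
      refine (eLpNorm_add_le (hVm i m).norm ((hvm i m).norm.const_mul _) hp).trans ?_
      rw [eLpNorm_norm]
      gcongr
      rw [show (fun x => C i * ‖v i m x - Ω.indicator u x‖) =
        C i • (fun x => ‖v i m x - Ω.indicator u x‖) from rfl, eLpNorm_const_smul, eLpNorm_norm]
    · filter_upwards [hkin] with m hm
      refine eLpNorm_mono_ae_real ((ae_restrict_iff' hΩm).2 (.of_forall fun x hx => ?_))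
      have hxc := subset_closure hx
      rw [gradient_sum_mul hθs (fun i => hvs i m)]
      have h1 : ∑ i, (θ i x • gradient (v i m) x + v i m x • gradient (θ i) x) - G x =
          ∑ i, (θ i x • (gradient (v i m) x - Ω.indicator G x) +
            (v i m x - Ω.indicator u x) • gradient (θ i) x) := by
        simp_rw [smul_sub, sub_smul, Finset.sum_add_distrib, Finset.sum_sub_distrib,
          ← Finset.sum_smul, ← Finset.smul_sum, hgradsum x hx, hθ1 x hxc,
          Set.indicator_of_mem hx]
        simp only [one_smul, smul_zero, sub_zero]
        abel
      rw [h1, Finset.sum_apply]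
      refine (norm_sum_le _ _).trans (Finset.sum_le_sum fun i _ => (norm_add_le _ _).trans ?_)
      rw [norm_smul, norm_smul, Real.norm_of_nonneg (hθ0 i x), mul_comm (C i)]
      refine add_le_add ?_ (mul_le_mul_of_nonneg_left (hC i x hxc) (norm_nonneg _))
      -- Outside `U i` the kernel may reach out of `Ω`, so the gradient of `v i m` is not controlled
      -- there; the factor `θ i x` removes it.
      by_cases h0 : θ i x = 0
      · simp [h0]
      · rw [hG.gradient_mollify hΩm hul hGl (hk i m) (hm i x ⟨hxc, hθU i x h0⟩)]
        exact mul_le_of_le_one_left (norm_nonneg _) (hθle i x hxc)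
  -- Where `θ i x ≠ 0`, the samples lie in `Ω` within `η` of `x`, so uniform continuity of `u` on
  -- the closure bounds each local error by `δ / 2`.
  · rw [Metric.tendstoUniformlyOn_iff]
    intro δ hδ
    obtain ⟨η, hη, huc⟩ := Metric.uniformContinuousOn_iff.1
      (hcpt.uniformContinuousOn_of_continuous hcont) (δ / 2) (by positivity)
    filter_upwards [hkin, eventually_all.2 fun i => (hrlim i).eventually (gt_mem_nhds hη)]
      with m hm hmη x hx
    have h1 : ∑ i, θ i x * v i m x - u x = ∑ i, θ i x * (v i m x - u x) := by
      simp_rw [mul_sub, Finset.sum_sub_distrib, ← Finset.sum_mul, hθ1 x hx, one_mul]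
    rw [dist_comm, dist_eq_norm, h1]
    refine lt_of_le_of_lt (norm_sum_le _ _) ?_
    refine lt_of_le_of_lt (b := ∑ i, θ i x * (δ / 2)) (Finset.sum_le_sum fun i _ => ?_) ?_
    · rw [norm_mul, Real.norm_of_nonneg (hθ0 i x)]
      by_cases h0 : θ i x = 0
      · simp [h0]
      · refine mul_le_mul_of_nonneg_left ?_ (hθ0 i x)
        refine (hk i m).norm_mollify_sub_le hul fun y hy => ?_
        have hy' := subset_tsupport _ hy
        have h2 := hm i x ⟨hx, hθU i x h0⟩ y hy'
        rw [Set.indicator_of_mem h2, ← dist_eq_norm]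
        refine (huc _ (subset_closure h2) x hx ?_).le
        simpa using (hknorm i m y hy').trans_lt (hmη i)
    · rw [← Finset.sum_mul, hθ1 x hx]
      linarith


/-! ### Surface measure in graph coordinates -/

theorem exists_hyperplane_prod_equiv {e : E n} (he : ‖e‖ = 1) :
    ∃ Φ : ((ℝ ∙ e)ᗮ × ℝ) ≃L[ℝ] E n, ∀ q, Φ q = (q.1 : E n) + q.2 • e := by
  let f : ((ℝ ∙ e)ᗮ × ℝ) →ₗ[ℝ] E n :=
    (ℝ ∙ e)ᗮ.subtype.coprod (LinearMap.toSpanSingleton ℝ (E n) e)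
  have hf : ∀ q, f q = (q.1 : E n) + q.2 • e := fun q => by simp [f]
  have hbij : Function.Bijective f := by
    constructor
    · rw [← LinearMap.ker_eq_bot, LinearMap.ker_eq_bot']
      rintro ⟨a, s⟩ h0
      rw [hf] at h0
      have h1 : ⟪e, (a : E n)⟫ = 0 := Submodule.mem_orthogonal_singleton_iff_inner_right.1 a.2
      have h2 : ⟪e, (a : E n) + s • e⟫ = s := by
        rw [inner_add_right, h1, inner_smul_right, real_inner_self_eq_norm_sq, he]; ring
      have hs : s = 0 := by rw [← h2, h0, inner_zero_right]
      subst hs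
      simpa using h0
    · intro x
      refine ⟨(⟨x - ⟪e, x⟫ • e, ?_⟩, ⟪e, x⟫), ?_⟩
      · rw [Submodule.mem_orthogonal_singleton_iff_inner_right, inner_sub_right, inner_smul_right,
          real_inner_self_eq_norm_sq, he]
        ring
      · rw [hf]; simp
  exact ⟨(LinearEquiv.ofBijective f hbij).toContinuousLinearEquiv, hf⟩

theorem finrank_hyperplane {e : E n} (he : ‖e‖ = 1) :
    ((Module.finrank ℝ (ℝ ∙ e)ᗮ : ℕ) : ℝ) = (n : ℝ) - 1 := by
  have h1 := Submodule.finrank_add_finrank_orthogonal (ℝ ∙ e)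
  rw [finrank_span_singleton (by rintro rfl; simp at he), finrank_euclideanSpace_fin] at h1
  have h2 : (n : ℝ) = 1 + (Module.finrank ℝ (ℝ ∙ e)ᗮ : ℕ) := by exact_mod_cast h1.symm
  linarith

/-- Fubini's theorem for the decomposition of space into lines of direction `e`. -/
theorem exists_lintegral_eq_lintegral_hyperplane {e : E n} (he : ‖e‖ = 1) :
    ∃ c : ℝ≥0, c ≠ 0 ∧ ∀ f : E n → ℝ≥0∞, Measurable f →
      ∫⁻ x, f x = c * ∫⁻ a : (ℝ ∙ e)ᗮ, (∫⁻ s : ℝ, f (a + s • e))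
        ∂(Measure.hausdorffMeasure ((n : ℝ) - 1)) := by
  obtain ⟨Φ, hΦ⟩ := exists_hyperplane_prod_equiv he
  rw [← finrank_hyperplane he]
  set μ : Measure (ℝ ∙ e)ᗮ := Measure.hausdorffMeasure (Module.finrank ℝ (ℝ ∙ e)ᗮ : ℝ)
  have : (Measure.map Φ (μ.prod (volume : Measure ℝ))).IsAddHaarMeasure :=
    Φ.isAddHaarMeasure_map _
  set ν := Measure.map Φ (μ.prod (volume : Measure ℝ)) with hν
  -- Uniqueness of Haar measure; the value of `c`, which reflects the normalisation of Hausdorff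
  -- measure, plays no role.
  obtain ⟨c, hc0, h⟩ : ∃ c : ℝ≥0, c ≠ 0 ∧ (volume : Measure (E n)) = c • ν :=
    ⟨_, (Measure.addHaarScalarFactor_pos_of_isAddHaarMeasure _ _).ne',
      Measure.isAddLeftInvariant_eq_smul _ _⟩
  refine ⟨c, hc0, fun f hf => ?_⟩
  rw [h, lintegral_smul_measure, ENNReal.smul_def, smul_eq_mul, hν, lintegral_map hf Φ.continuous.measurable,
    lintegral_prod (fun q => f (Φ q)) (hf.comp Φ.continuous.measurable).aemeasurable]
  simp only [hΦ]

/-- The parametrisation of the graph `{h = 0}` by the hyperplane orthogonal to `e`. -/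
def graphMap (e : E n) (h : E n → ℝ) (a : (ℝ ∙ e)ᗮ) : E n := a + h a • e

/-- Pythagoras: the vertical part of a difference is orthogonal to the hyperplane part. -/
theorem antilipschitzWith_graphMap (e : E n) (h : E n → ℝ) :
    AntilipschitzWith 1 (graphMap e h) := by
  refine AntilipschitzWith.of_le_mul_dist fun a b => ?_
  rw [NNReal.coe_one, one_mul, dist_eq_norm, dist_eq_norm]
  have h1 : graphMap e h a - graphMap e h b = ((a - b : (ℝ ∙ e)ᗮ) : E n) + (h a - h b) • e := by
    simp only [graphMap, Submodule.coe_sub, sub_smul]; abel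
  have h2 : ⟪((a - b : (ℝ ∙ e)ᗮ) : E n), (h a - h b) • e⟫ = 0 := by
    rw [inner_smul_right, Submodule.mem_orthogonal_singleton_iff_inner_left.1 (a - b).2, mul_zero]
  rw [h1, show ‖a - b‖ = ‖((a - b : (ℝ ∙ e)ᗮ) : E n)‖ from rfl]
  refine le_of_sq_le_sq ?_ (norm_nonneg _)
  rw [sq ‖_ + _‖, norm_add_sq_eq_norm_sq_add_norm_sq_of_inner_eq_zero _ _ h2]
  nlinarith [norm_nonneg ((h a - h b) • e)]

namespace IsGraphChart

variable {Ω : Set (E n)} {x₀ e : E n} {L : ℝ≥0} {h : E n → ℝ} {R : ℝ}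

theorem range_graphMap (hc : IsGraphChart Ω x₀ e L h R) :
    Set.range (graphMap e h) = {x | h x = 0} := by
  obtain ⟨Φ, hΦ⟩ := exists_hyperplane_prod_equiv hc.norm_eq_one
  ext x
  constructor
  · rintro ⟨a, rfl⟩
    simp [graphMap, hc.map_add_smul]
  · intro hx
    obtain ⟨⟨a, s⟩, rfl⟩ := Φ.surjective x
    rw [hΦ] at hx ⊢
    rw [Set.mem_ofPred_eq, hc.map_add_smul, sub_eq_zero] at hx
    exact ⟨a, by rw [graphMap, hx]⟩

theorem lipschitzWith_graphMap (hc : IsGraphChart Ω x₀ e L h R) :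
    LipschitzWith (1 + L) (graphMap e h) := by
  refine LipschitzWith.add (LipschitzWith.subtype_val _) ?_
  refine LipschitzWith.of_dist_le_mul fun a b => ?_
  rw [dist_eq_norm, ← sub_smul, norm_smul, hc.norm_eq_one, mul_one]
  exact hc.lipschitz.dist_le_mul (a : E n) b

/-- Integration over space compared with integration over the graph, then over the lines transversal
to it. -/
theorem exists_lintegral_graph_comparison (hc : IsGraphChart Ω x₀ e L h R) :
    ∃ C : ℝ≥0, ∀ f : E n → ℝ≥0∞, Measurable f →
      (∫⁻ x in {x | h x = 0}, (∫⁻ t : ℝ, f (x - t • e))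
          ∂(Measure.hausdorffMeasure ((n : ℝ) - 1)) ≤ C * ∫⁻ x, f x) ∧
      ∫⁻ x, f x ≤ C * ∫⁻ x in {x | h x = 0}, (∫⁻ t : ℝ, f (x - t • e))
          ∂(Measure.hausdorffMeasure ((n : ℝ) - 1)) := by
  obtain ⟨c, hc0, hfub⟩ := exists_lintegral_eq_lintegral_hyperplane hc.norm_eq_one
  set d : ℝ := (n : ℝ) - 1 with hd
  have hd0 : 0 ≤ d := by rw [hd, ← finrank_hyperplane hc.norm_eq_one]; positivity
  set μ : Measure (ℝ ∙ e)ᗮ := Measure.hausdorffMeasure d with hμ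
  set σ : Measure (E n) := (Measure.hausdorffMeasure d).restrict {x | h x = 0} with hσ
  set g := graphMap e h with hg
  have hgm : Measurable g := hc.lipschitzWith_graphMap.continuous.measurable
  have hset : ∀ S : Set (E n), MeasurableSet S →
      σ S = Measure.hausdorffMeasure d (g '' (g ⁻¹' S)) := fun S hS => by
    rw [hσ, Measure.restrict_apply hS, Set.image_preimage_eq_inter_range, hc.range_graphMap]
  set A : ℝ≥0 := (1 + L) ^ d with hA
  -- `g` is Lipschitz and expands distances, so surface measure on the graph lies between the image
  -- of the hyperplane measure and `A` times it.
  have hup : σ ≤ A • Measure.map g μ := by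
    refine Measure.le_iff.2 fun S hS => ?_
    rw [hset S hS, Measure.smul_apply, Measure.map_apply hgm hS]
    refine (hc.lipschitzWith_graphMap.hausdorffMeasure_image_le hd0 _).trans_eq ?_
    rw [hA, ENNReal.smul_def, smul_eq_mul, ENNReal.coe_rpow_of_nonneg _ hd0]
  have hlow : Measure.map g μ ≤ σ := by
    refine Measure.le_iff.2 fun S hS => ?_
    rw [hset S hS, Measure.map_apply hgm hS]
    refine ((antilipschitzWith_graphMap e h).le_hausdorffMeasure_image hd0 _).trans_eq ?_
    simp [hg]
  have hvol : ∀ f : E n → ℝ≥0∞, Measurable f →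
      ∫⁻ x, f x = c * ∫⁻ x, (∫⁻ t : ℝ, f (x - t • e)) ∂Measure.map g μ := fun f hf => by
    have hm : Measurable fun x => ∫⁻ t : ℝ, f (x - t • e) := by
      refine Measurable.lintegral_prod_right (f := fun (x : E n) (t : ℝ) => f (x - t • e)) ?_
      exact hf.comp (Continuous.measurable (f := fun q : E n × ℝ => q.1 - q.2 • e) (by fun_prop))
    rw [hfub f hf, lintegral_map hm hgm]
    congr 1
    refine lintegral_congr fun a => ?_
    -- The substitution `s = h a - t` measures position on the line from its crossing with the
    -- graph.
    rw [← lintegral_sub_left_eq_self _ (h a)]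
    refine lintegral_congr fun t => ?_
    rw [hg, graphMap, sub_smul, add_sub_assoc]
  refine ⟨A / c + c, fun f hf => ⟨?_, ?_⟩⟩
  · calc ∫⁻ x, (∫⁻ t : ℝ, f (x - t • e)) ∂σ
        ≤ ∫⁻ x, (∫⁻ t : ℝ, f (x - t • e)) ∂(A • Measure.map g μ) := lintegral_mono' hup le_rfl
      _ = (A / c : ℝ≥0) * (c * ∫⁻ x, (∫⁻ t : ℝ, f (x - t • e)) ∂Measure.map g μ) := by
        rw [lintegral_smul_measure, ENNReal.smul_def, smul_eq_mul, ← mul_assoc, ← ENNReal.coe_mul,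
          div_mul_cancel₀ _ hc0]
      _ = (A / c : ℝ≥0) * ∫⁻ x, f x := by rw [hvol f hf]
      _ ≤ _ := by gcongr; exact le_self_add
  · rw [hvol f hf]
    gcongr
    · exact le_add_self

end IsGraphChart


/-! ### The trace inequality and the boundary layer inequality -/

theorem enorm_sub_le_lintegral_gradient {φ : E n → ℝ} (hφ : ContDiff ℝ ∞ φ) {e : E n}
    (he : ‖e‖ = 1) (y : E n) {t : ℝ} (ht : 0 ≤ t) :
    ‖φ (y - t • e) - φ y‖ₑ ≤ ∫⁻ s in Set.Ioc 0 t, ‖gradient φ (y - s • e)‖ₑ := by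
  have hder : ∀ s : ℝ, HasDerivAt (fun s : ℝ => φ (y - s • e)) (-(fderiv ℝ φ (y - s • e) e)) s :=
    fun s => by
      have h1 : HasDerivAt (fun s : ℝ => y - s • e) (-e) s := by
        simpa using ((hasDerivAt_id s).smul_const e).const_sub y
      have h2 := (hφ.differentiable (by simp) (y - s • e)).hasFDerivAt.comp_hasDerivAt s h1
      rw [map_neg] at h2
      exact h2
  have hcont : Continuous fun s : ℝ => -(fderiv ℝ φ (y - s • e) e) :=
    (((hφ.continuous_fderiv (by simp)).comp (by fun_prop)).clm_apply continuous_const).neg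
  have h := intervalIntegral.integral_eq_sub_of_hasDerivAt (a := 0) (b := t) (fun s _ => hder s)
    (hcont.intervalIntegrable _ _)
  rw [zero_smul, sub_zero, intervalIntegral.integral_of_le ht] at h
  rw [← h]
  refine (enorm_integral_le_lintegral_enorm _).trans (lintegral_mono fun s => ?_)
  rw [enorm_le_iff_norm_le, norm_neg, norm_gradient]
  simpa [he] using (fderiv ℝ φ (y - s • e)).le_opNorm e

theorem continuous_gradient {φ : E n → ℝ} (hφ : ContDiff ℝ ∞ φ) : Continuous (gradient φ) :=
  (InnerProductSpace.toDual ℝ (E n)).symm.continuous.comp (hφ.continuous_fderiv (by simp))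

theorem measurable_enorm_gradient {φ : E n → ℝ} (hφ : ContDiff ℝ ∞ φ) :
    Measurable fun x => ‖gradient φ x‖ₑ := (continuous_gradient hφ).enorm.measurable

/-- Average over `t ∈ (0, r]` the bound of `|φ y|` by `|φ (y - t • e)|` plus the gradient integral,
then apply Jensen. Since `r ≤ 1`, that integral is at most its average. -/
theorem enorm_rpow_le_lintegral_line {φ : E n → ℝ} (hφ : ContDiff ℝ ∞ φ) {e : E n}
    (he : ‖e‖ = 1) (y : E n) {r : ℝ} (hr : 0 < r) (hr1 : r ≤ 1) {p : ℝ} (hp : 1 ≤ p) :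
    ‖φ y‖ₑ ^ p ≤ (ENNReal.ofReal r)⁻¹ *
      ∫⁻ t in Set.Ioc 0 r, (‖φ (y - t • e)‖ₑ + ‖gradient φ (y - t • e)‖ₑ) ^ p := by
  have hr0 : ENNReal.ofReal r ≠ 0 := by simpa using hr
  set ν : Measure ℝ := (ENNReal.ofReal r)⁻¹ • volume.restrict (Set.Ioc 0 r) with hν
  have hνp : IsProbabilityMeasure ν := ⟨by
    simp [hν, ENNReal.inv_mul_cancel hr0]⟩
  have hline : Continuous fun t : ℝ => y - t • e := by fun_prop
  have hm1 : Measurable fun t : ℝ => ‖φ (y - t • e)‖ₑ :=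
    (hφ.continuous.comp hline).enorm.measurable
  have hm2 : Measurable fun t : ℝ => ‖gradient φ (y - t • e)‖ₑ :=
    (measurable_enorm_gradient hφ).comp hline.measurable
  have h1 : ‖φ y‖ₑ ≤ ∫⁻ t, (‖φ (y - t • e)‖ₑ + ‖gradient φ (y - t • e)‖ₑ) ∂ν := by
    rw [lintegral_add_left hm1]
    set I := ∫⁻ t, ‖gradient φ (y - t • e)‖ₑ ∂ν with hI
    have h2 : ∀ t ∈ Set.Ioc 0 r, ‖φ y‖ₑ ≤ ‖φ (y - t • e)‖ₑ + I := fun t ht => by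
      have h3 : ‖φ y‖ₑ ≤ ‖φ (y - t • e)‖ₑ + ‖φ (y - t • e) - φ y‖ₑ := by
        have := enorm_sub_le (E := ℝ) (a := φ (y - t • e)) (b := φ (y - t • e) - φ y)
        rwa [sub_sub_cancel] at this
      refine h3.trans ?_
      gcongr
      refine (enorm_sub_le_lintegral_gradient hφ he y ht.1.le).trans ?_
      refine (lintegral_mono_set (Set.Ioc_subset_Ioc_right ht.2)).trans ?_
      rw [hI, hν, lintegral_smul_measure, smul_eq_mul]
      refine le_mul_of_one_le_left zero_le ?_
      rw [ENNReal.one_le_inv, ← ENNReal.ofReal_one]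
      exact ENNReal.ofReal_le_ofReal hr1
    have h4 : ∀ᵐ t ∂ν, ‖φ y‖ₑ ≤ ‖φ (y - t • e)‖ₑ + I :=
      Measure.ae_smul_measure ((ae_restrict_iff' measurableSet_Ioc).2 (.of_forall h2)) _
    have h5 := lintegral_mono_ae h4
    rwa [lintegral_add_left hm1, lintegral_const, lintegral_const, measure_univ, mul_one,
      mul_one] at h5
  calc ‖φ y‖ₑ ^ p ≤ (∫⁻ t, (‖φ (y - t • e)‖ₑ + ‖gradient φ (y - t • e)‖ₑ) ∂ν) ^ p := by gcongr
    _ ≤ ∫⁻ t, (‖φ (y - t • e)‖ₑ + ‖gradient φ (y - t • e)‖ₑ) ^ p ∂ν :=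
      lintegral_rpow_le_of_isProbabilityMeasure ν hp (hm1.add hm2).aemeasurable
    _ = _ := by rw [hν, lintegral_smul_measure, smul_eq_mul]

namespace IsGraphChart

variable {Ω : Set (E n)} {x₀ e : E n} {L : ℝ≥0} {h : E n → ℝ} {R : ℝ}

theorem map_sub_smul (hc : IsGraphChart Ω x₀ e L h R) (x : E n) (t : ℝ) :
    h (x - t • e) = h x + t := by
  have := hc.map_add_smul x (-t)
  rw [neg_smul, ← sub_eq_add_neg] at this
  rw [this, sub_neg_eq_add]

theorem dist_sub_smul (hc : IsGraphChart Ω x₀ e L h R) (x : E n) {t : ℝ} (ht : 0 ≤ t) :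
    dist (x - t • e) x = t := by
  rw [dist_eq_norm, sub_sub_cancel_left, norm_neg, norm_smul, hc.norm_eq_one,
    Real.norm_of_nonneg ht, mul_one]

theorem exists_local_trace_inequality (hc : IsGraphChart Ω x₀ e L h R) (hΩ : IsOpen Ω) :
    ∃ U ∈ 𝓝 x₀, ∃ C : ℝ≥0, ∀ p : ℝ, 1 ≤ p → ∀ φ : E n → ℝ, ContDiff ℝ ∞ φ →
      ∫⁻ y in U, ‖φ y‖ₑ ^ p ∂(surfaceMeasure Ω) ≤
        C * ∫⁻ x in Ω, (‖φ x‖ₑ + ‖gradient φ x‖ₑ) ^ p := by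
  obtain ⟨C, hC⟩ := hc.exists_lintegral_graph_comparison
  have hR := hc.radius_pos
  -- Segments of length `r` issued from the ball of radius `r` stay in the chart.
  obtain ⟨r, hr0, hr1, hrR⟩ : ∃ r : ℝ, 0 < r ∧ r ≤ 1 ∧ r + r ≤ R :=
    ⟨min 1 (R / 2), by positivity, min_le_left _ _, by linarith [min_le_right 1 (R / 2)]⟩
  refine ⟨Metric.ball x₀ r, Metric.ball_mem_nhds _ hr0, (Real.toNNReal r)⁻¹ * C,
    fun p hp φ hφ => ?_⟩
  set F : E n → ℝ≥0∞ := fun x => (‖φ x‖ₑ + ‖gradient φ x‖ₑ) ^ p with hF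
  have hFm : Measurable F :=
    (hφ.continuous.enorm.measurable.add (measurable_enorm_gradient hφ)).pow_const p
  have hsub : Metric.ball x₀ r ∩ frontier Ω ⊆ {x | h x = 0} := fun y hy =>
    (hc.mem_frontier_iff hΩ (Metric.ball_subset_ball (by linarith) hy.1)).1 hy.2
  rw [surfaceMeasure, Measure.restrict_restrict Metric.isOpen_ball.measurableSet]
  have hpt : ∀ y ∈ Metric.ball x₀ r ∩ frontier Ω,
      ‖φ y‖ₑ ^ p ≤ (ENNReal.ofReal r)⁻¹ * ∫⁻ t : ℝ, Ω.indicator F (y - t • e) := fun y hy => by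
    refine (enorm_rpow_le_lintegral_line hφ hc.norm_eq_one y hr0 hr1 hp).trans ?_
    refine mul_le_mul_right ?_ _
    rw [← lintegral_indicator measurableSet_Ioc]
    refine lintegral_mono fun t => ?_
    by_cases ht : t ∈ Set.Ioc 0 r
    · have h1 : y - t • e ∈ Metric.ball x₀ R := by
        have h2 := hy.1
        rw [Metric.mem_ball] at h2 ⊢
        linarith [dist_triangle (y - t • e) y x₀, hc.dist_sub_smul y ht.1.le, ht.2]
      have h2 : y - t • e ∈ Ω := by
        rw [hc.mem_iff _ h1, hc.map_sub_smul, hsub hy]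
        linarith [ht.1]
      rw [Set.indicator_of_mem ht, Set.indicator_of_mem h2]
    · rw [Set.indicator_of_notMem ht]; exact zero_le
  calc _ ≤ ∫⁻ y in Metric.ball x₀ r ∩ frontier Ω, (ENNReal.ofReal r)⁻¹ *
          (∫⁻ t : ℝ, Ω.indicator F (y - t • e)) ∂(Measure.hausdorffMeasure ((n : ℝ) - 1)) :=
        setLIntegral_mono' (Metric.isOpen_ball.measurableSet.inter
          isClosed_frontier.measurableSet) hpt
    _ ≤ ∫⁻ y in {x | h x = 0}, (ENNReal.ofReal r)⁻¹ *
          (∫⁻ t : ℝ, Ω.indicator F (y - t • e)) ∂(Measure.hausdorffMeasure ((n : ℝ) - 1)) :=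
        lintegral_mono_set hsub
    _ ≤ (ENNReal.ofReal r)⁻¹ * (C * ∫⁻ x, Ω.indicator F x) := by
        rw [lintegral_const_mul' _ _ (by simpa using hr0)]
        gcongr
        exact (hC _ (hFm.indicator hΩ.measurableSet)).1
    _ = _ := by
        rw [lintegral_indicator hΩ.measurableSet, ENNReal.coe_mul,
          ENNReal.coe_inv (Real.toNNReal_pos.2 hr0).ne', mul_assoc]
        rfl

end IsGraphChart

theorem IsLipschitzDomain.exists_trace_inequality {Ω : Set (E n)} (hΩ : IsLipschitzDomain Ω) :
    ∃ C : ℝ≥0, ∀ p : ℝ, 1 ≤ p → ∀ φ : E n → ℝ, ContDiff ℝ ∞ φ →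
      ∫⁻ y, ‖φ y‖ₑ ^ p ∂(surfaceMeasure Ω) ≤
        C * ∫⁻ x in Ω, (‖φ x‖ₑ + ‖gradient φ x‖ₑ) ^ p := by
  have hcpt : IsCompact (frontier Ω) :=
    hΩ.2.1.isCompact_closure.of_isClosed_subset isClosed_frontier frontier_subset_closure
  have key : ∃ C : ℝ≥0, ∀ p : ℝ, 1 ≤ p → ∀ φ : E n → ℝ, ContDiff ℝ ∞ φ →
      ∫⁻ y in frontier Ω, ‖φ y‖ₑ ^ p ∂(surfaceMeasure Ω) ≤
        C * ∫⁻ x in Ω, (‖φ x‖ₑ + ‖gradient φ x‖ₑ) ^ p := by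
    refine hcpt.induction_on (p := fun s => ∃ C : ℝ≥0, ∀ p : ℝ, 1 ≤ p → ∀ φ : E n → ℝ,
      ContDiff ℝ ∞ φ → ∫⁻ y in s, ‖φ y‖ₑ ^ p ∂(surfaceMeasure Ω) ≤
        C * ∫⁻ x in Ω, (‖φ x‖ₑ + ‖gradient φ x‖ₑ) ^ p) ?_ ?_ ?_ ?_
    · exact ⟨0, by simp⟩
    · rintro s t hst ⟨C, hC⟩
      exact ⟨C, fun p hp φ hφ => (lintegral_mono_set hst).trans (hC p hp φ hφ)⟩
    · rintro s t ⟨C, hC⟩ ⟨D, hD⟩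
      refine ⟨C + D, fun p hp φ hφ => (lintegral_union_le _ _ _).trans ?_⟩
      rw [ENNReal.coe_add, add_mul]
      exact add_le_add (hC p hp φ hφ) (hD p hp φ hφ)
    · intro x hx
      obtain ⟨e, L, h, R, hc⟩ := hΩ.exists_isGraphChart hx
      obtain ⟨U, hU, H⟩ := hc.exists_local_trace_inequality hΩ.1
      exact ⟨U, mem_nhdsWithin_of_mem_nhds hU, H⟩
  obtain ⟨C, hC⟩ := key
  refine ⟨C, fun p hp φ hφ => ?_⟩
  have := hC p hp φ hφ
  rwa [surfaceMeasure, Measure.restrict_restrict isClosed_frontier.measurableSet,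
    Set.inter_self] at this

/-- The points of `Ω` at distance less than `δ` from its complement. -/
def boundaryLayer (Ω : Set (E n)) (δ : ℝ) : Set (E n) := {x ∈ Ω | Metric.infDist x Ωᶜ < δ}

theorem boundaryLayer_mono (Ω : Set (E n)) {δ δ' : ℝ} (h : δ ≤ δ') :
    boundaryLayer Ω δ ⊆ boundaryLayer Ω δ' := fun _ hx => ⟨hx.1, hx.2.trans_le h⟩

theorem isOpen_boundaryLayer {Ω : Set (E n)} (hΩ : IsOpen Ω) (δ : ℝ) :
    IsOpen (boundaryLayer Ω δ) :=
  hΩ.inter (isOpen_lt (Metric.continuous_infDist_pt _) continuous_const)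

/-- A point of the layer is within `δ` of a point where `h ≤ 0`, so its height is at most `L δ`: it
is `y - t • e` with `y` on the graph and `0 < t ≤ L δ`. Bounding `φ` by its value at `y` plus the
gradient along the segment, and integrating in `t`, yields the factor `δ`. The gradient is
integrated over a layer only, so that this term vanishes as `δ → 0`. -/
theorem IsGraphChart.exists_local_boundaryLayer_inequality {Ω : Set (E n)} {x₀ e : E n} {L : ℝ≥0}
    {h : E n → ℝ} {R : ℝ} (hc : IsGraphChart Ω x₀ e L h R) (hΩ : IsOpen Ω)
    (hx₀ : x₀ ∈ frontier Ω) :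
    ∃ U : Set (E n), IsOpen U ∧ x₀ ∈ U ∧ ∃ (C M : ℝ≥0) (δ₀ : ℝ), 0 < δ₀ ∧
      ∀ δ : ℝ, 0 < δ → δ < δ₀ → ∀ φ : E n → ℝ, ContDiff ℝ ∞ φ →
      ∫⁻ x in boundaryLayer Ω δ ∩ U, ‖φ x‖ₑ ≤ C * ENNReal.ofReal δ *
        (∫⁻ y, ‖φ y‖ₑ ∂(surfaceMeasure Ω) +
          ∫⁻ x in boundaryLayer Ω (M * δ), ‖gradient φ x‖ₑ) := by
  obtain ⟨C, hC⟩ := hc.exists_lintegral_graph_comparison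
  have hR := hc.radius_pos
  have hL : (0 : ℝ) ≤ L := L.2
  -- With `(L + 1) δ < R / 3`, going from the layer to the graph and back into `Ω` costs at most `2
  -- L δ` and stays in the chart. `M = L + 1` rather than `L` because the layer is defined by a
  -- strict inequality.
  refine ⟨Metric.ball x₀ (R / 3), Metric.isOpen_ball, Metric.mem_ball_self (by positivity),
    C * L * (1 + C), L + 1, R / 3 / (L + 1), by positivity, fun δ hδ hδ₀ φ hφ => ?_⟩
  rw [lt_div_iff₀ (by positivity)] at hδ₀
  have hLδ : 0 ≤ L * δ := by positivity
  set S : Set (E n) := boundaryLayer Ω δ ∩ Metric.ball x₀ (R / 3) with hS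
  set T : Set (E n) := boundaryLayer Ω ((L + 1 : ℝ≥0) * δ) with hT
  have hSm : MeasurableSet S := ((isOpen_boundaryLayer hΩ _).inter Metric.isOpen_ball).measurableSet
  have hTm : MeasurableSet T := (isOpen_boundaryLayer hΩ _).measurableSet
  set f : E n → ℝ≥0∞ := fun x => ‖φ x‖ₑ with hf
  set g : E n → ℝ≥0∞ := fun x => ‖gradient φ x‖ₑ with hg
  have hfm : Measurable f := hφ.continuous.enorm.measurable
  have hgm : Measurable g := measurable_enorm_gradient hφ
  have hheight : ∀ x ∈ S, 0 < h x ∧ h x ≤ L * δ := fun x hx => by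
    have hxb := Metric.mem_ball.1 hx.2
    refine ⟨(hc.mem_iff x (Metric.ball_subset_ball (by linarith) hx.2)).1 hx.1.1, ?_⟩
    have hne : (Ωᶜ).Nonempty := ⟨x₀, (hΩ.frontier_eq ▸ hx₀).2⟩
    obtain ⟨z, hz, hxz⟩ := (Metric.infDist_lt_iff hne).1 hx.1.2
    have hzb : z ∈ Metric.ball x₀ R := by
      rw [Metric.mem_ball]
      rw [dist_comm] at hxz
      nlinarith [dist_triangle z x x₀]
    have h1 : h z ≤ 0 := not_lt.1 fun hlt => hz ((hc.mem_iff z hzb).2 hlt)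
    have h2 := hc.le_map_add x z
    nlinarith
  have hpt : ∀ y ∈ {x | h x = 0}, ∫⁻ t : ℝ, S.indicator f (y - t • e) ≤
      ENNReal.ofReal (L * δ) *
        ((frontier Ω).indicator f y + ∫⁻ t : ℝ, T.indicator g (y - t • e)) := fun y hy => by
    rw [Set.mem_ofPred_eq] at hy
    by_cases hex : ∃ t : ℝ, y - t • e ∈ S
    · obtain ⟨t₀, ht₀⟩ := hex
      have h1 := hheight _ ht₀
      rw [hc.map_sub_smul, hy, zero_add] at h1
      have hyb : dist y x₀ < R / 3 + L * δ := by
        have := Metric.mem_ball.1 ht₀.2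
        have h2 := hc.dist_sub_smul y h1.1.le
        rw [dist_comm] at h2
        linarith [dist_triangle y (y - t₀ • e) x₀]
      have hyf : y ∈ frontier Ω := by
        rw [hc.mem_frontier_iff hΩ (Metric.mem_ball.2 (by nlinarith)), hy]
      have hin : ∀ s ∈ Set.Ioc 0 (L * δ), y - s • e ∈ T := fun s hs => by
        have h2 := hc.dist_sub_smul y hs.1.le
        have h3 : y - s • e ∈ Metric.ball x₀ R := by
          rw [Metric.mem_ball]
          nlinarith [dist_triangle (y - s • e) y x₀, hs.2]
        refine ⟨(hc.mem_iff _ h3).2 ?_, ?_⟩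
        · rw [hc.map_sub_smul, hy]; linarith [hs.1]
        · rw [hΩ.frontier_eq] at hyf
          refine (Metric.infDist_le_dist_of_mem hyf.2).trans_lt ?_
          rw [h2]; push_cast; linarith [hs.2]
      rw [Set.indicator_of_mem hyf]
      calc ∫⁻ t : ℝ, S.indicator f (y - t • e)
          ≤ ∫⁻ t : ℝ, (Set.Ioc 0 (L * δ)).indicator
              (fun _ => f y + ∫⁻ t : ℝ, T.indicator g (y - t • e)) t := by
            refine lintegral_mono fun t => ?_
            by_cases ht : y - t • e ∈ S
            · have h2 := hheight _ ht
              rw [hc.map_sub_smul, hy, zero_add] at h2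
              rw [Set.indicator_of_mem ht, Set.indicator_of_mem (show t ∈ Set.Ioc 0 (L * δ) from h2)]
              have h3 : f (y - t • e) ≤ f y + ‖φ (y - t • e) - φ y‖ₑ := by
                have := enorm_add_le (E := ℝ) (φ y) (φ (y - t • e) - φ y)
                rwa [add_sub_cancel] at this
              refine h3.trans ?_
              gcongr
              refine (enorm_sub_le_lintegral_gradient hφ hc.norm_eq_one y h2.1.le).trans ?_
              rw [← lintegral_indicator measurableSet_Ioc]
              refine lintegral_mono fun s => ?_
              by_cases hs : s ∈ Set.Ioc 0 t
              · rw [Set.indicator_of_mem hs, Set.indicator_of_mem (hin s ⟨hs.1, hs.2.trans h2.2⟩)]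
              · rw [Set.indicator_of_notMem hs]; exact zero_le
            · rw [Set.indicator_of_notMem ht]; exact zero_le
        _ = _ := by
            rw [lintegral_indicator_const measurableSet_Ioc, Real.volume_Ioc, sub_zero, mul_comm]
    · have : ∀ t : ℝ, S.indicator f (y - t • e) = 0 := fun t =>
        Set.indicator_of_notMem (fun ht => hex ⟨t, ht⟩) _
      simp [this]
  rw [← lintegral_indicator hSm]
  have hAm : Measurable fun y => (frontier Ω).indicator f y :=
    hfm.indicator isClosed_frontier.measurableSet
  have h1 : ∫⁻ y in {x | h x = 0}, (frontier Ω).indicator f y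
      ∂(Measure.hausdorffMeasure ((n : ℝ) - 1)) ≤ ∫⁻ y, f y ∂(surfaceMeasure Ω) := by
    rw [surfaceMeasure, ← lintegral_indicator isClosed_frontier.measurableSet]
    exact lintegral_mono' Measure.restrict_le_self le_rfl
  have h2 := (hC _ (hgm.indicator hTm)).1
  rw [lintegral_indicator hTm] at h2
  have hzm : MeasurableSet {x | h x = 0} :=
    (isClosed_eq hc.lipschitz.continuous continuous_const).measurableSet
  calc ∫⁻ x, S.indicator f x
      ≤ C * ∫⁻ y in {x | h x = 0}, (∫⁻ t : ℝ, S.indicator f (y - t • e))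
          ∂(Measure.hausdorffMeasure ((n : ℝ) - 1)) := (hC _ (hfm.indicator hSm)).2
    _ ≤ C * ∫⁻ y in {x | h x = 0}, ENNReal.ofReal (L * δ) *
        ((frontier Ω).indicator f y + ∫⁻ t : ℝ, T.indicator g (y - t • e))
          ∂(Measure.hausdorffMeasure ((n : ℝ) - 1)) := by
        gcongr 1
        exact setLIntegral_mono' hzm hpt
    _ ≤ C * (ENNReal.ofReal (L * δ) * (∫⁻ y, f y ∂(surfaceMeasure Ω) + C * ∫⁻ x in T, g x)) := by
        rw [lintegral_const_mul' _ _ ENNReal.ofReal_ne_top, lintegral_add_left hAm]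
        gcongr
    _ ≤ C * (ENNReal.ofReal (L * δ) * ((1 + C) * (∫⁻ y, f y ∂(surfaceMeasure Ω) +
          ∫⁻ x in T, g x))) := by
        rw [mul_add (1 + C : ℝ≥0∞)]
        gcongr
        · exact le_mul_of_one_le_left zero_le le_self_add
        · exact le_add_self
    _ = _ := by
        rw [ENNReal.ofReal_mul hL, ENNReal.ofReal_coe_nnreal]
        push_cast
        ring

theorem IsLipschitzDomain.exists_boundaryLayer_inequality {Ω : Set (E n)} (hn : 1 ≤ n)
    (hΩ : IsLipschitzDomain Ω) :
    ∃ (C M : ℝ≥0) (δ₀ : ℝ), 0 < δ₀ ∧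
      ∀ δ : ℝ, 0 < δ → δ < δ₀ → ∀ φ : E n → ℝ, ContDiff ℝ ∞ φ →
      ∫⁻ x in boundaryLayer Ω δ, ‖φ x‖ₑ ≤ C * ENNReal.ofReal δ *
        (∫⁻ y, ‖φ y‖ₑ ∂(surfaceMeasure Ω) +
          ∫⁻ x in boundaryLayer Ω (M * δ), ‖gradient φ x‖ₑ) := by
  have hcpt : IsCompact (frontier Ω) :=
    hΩ.2.1.isCompact_closure.of_isClosed_subset isClosed_frontier frontier_subset_closure
  obtain ⟨U, hUo, hUf, C, M, δ₀, hδ₀, H⟩ : ∃ U : Set (E n), IsOpen U ∧ frontier Ω ⊆ U ∧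
      ∃ (C M : ℝ≥0) (δ₀ : ℝ), 0 < δ₀ ∧
      ∀ δ : ℝ, 0 < δ → δ < δ₀ → ∀ φ : E n → ℝ, ContDiff ℝ ∞ φ →
      ∫⁻ x in boundaryLayer Ω δ ∩ U, ‖φ x‖ₑ ≤ C * ENNReal.ofReal δ *
        (∫⁻ y, ‖φ y‖ₑ ∂(surfaceMeasure Ω) +
          ∫⁻ x in boundaryLayer Ω (M * δ), ‖gradient φ x‖ₑ) := by
    refine hcpt.induction_on (p := fun s => ∃ U : Set (E n), IsOpen U ∧ s ⊆ U ∧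
      ∃ (C M : ℝ≥0) (δ₀ : ℝ), 0 < δ₀ ∧
      ∀ δ : ℝ, 0 < δ → δ < δ₀ → ∀ φ : E n → ℝ, ContDiff ℝ ∞ φ →
      ∫⁻ x in boundaryLayer Ω δ ∩ U, ‖φ x‖ₑ ≤ C * ENNReal.ofReal δ *
        (∫⁻ y, ‖φ y‖ₑ ∂(surfaceMeasure Ω) +
          ∫⁻ x in boundaryLayer Ω (M * δ), ‖gradient φ x‖ₑ)) ?_ ?_ ?_ ?_
    · exact ⟨∅, isOpen_empty, subset_rfl, 0, 0, 1, one_pos, by simp⟩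
    · rintro s t hst ⟨U, hU, htU, H⟩
      exact ⟨U, hU, hst.trans htU, H⟩
    · rintro s t ⟨U, hU, hsU, C, M, δ₀, hδ₀, H⟩ ⟨U', hU', htU', C', M', δ₀', hδ₀', H'⟩
      refine ⟨U ∪ U', hU.union hU', Set.union_subset_union hsU htU', C + C', M + M', min δ₀ δ₀',
        lt_min hδ₀ hδ₀', fun δ hδ hlt φ hφ => ?_⟩
      rw [Set.inter_union_distrib_left, ENNReal.coe_add, add_mul, add_mul]
      refine (lintegral_union_le _ _ _).trans (add_le_add ?_ ?_)
      · refine (H δ hδ (hlt.trans_le (min_le_left _ _)) φ hφ).trans ?_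
        gcongr
        refine boundaryLayer_mono Ω ?_
        gcongr
        exact le_self_add
      · refine (H' δ hδ (hlt.trans_le (min_le_right _ _)) φ hφ).trans ?_
        gcongr
        refine boundaryLayer_mono Ω ?_
        gcongr
        exact le_add_self
    · intro x hx
      obtain ⟨e, L, h, R, hc⟩ := hΩ.exists_isGraphChart hx
      obtain ⟨U, hU, hxU, H⟩ := hc.exists_local_boundaryLayer_inequality hΩ.1 hx
      exact ⟨U, mem_nhdsWithin_of_mem_nhds (hU.mem_nhds hxU), U, hU, subset_rfl, H⟩
  -- The distance to the complement is attained on `∂Ω`, so a thin enough layer lies entirely in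
  -- `U`. This uses `Ω ≠ univ`, which follows from boundedness only in positive dimension.
  obtain ⟨η, hη, hthick⟩ := hcpt.exists_thickening_subset_open hUo hUf
  refine ⟨C, M, min δ₀ η, lt_min hδ₀ hη, fun δ hδ hlt φ hφ => ?_⟩
  have hsub : boundaryLayer Ω δ ⊆ U := fun x hx => by
    have hne : Ω ≠ Set.univ := by
      rintro rfl
      have : Nonempty (Fin n) := ⟨⟨0, hn⟩⟩
      exact NormedSpace.unbounded_univ ℝ (E n) hΩ.2.1
    obtain ⟨y, hy, hxy⟩ := exists_mem_frontier_infDist_compl_eq_dist hx.1 hne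
    refine hthick (Metric.mem_thickening_iff.2 ⟨y, hy, ?_⟩)
    rw [← hxy]
    exact hx.2.trans (hlt.trans_le (min_le_right _ _))
  have := H δ hδ (hlt.trans_le (min_le_left _ _)) φ hφ
  rwa [Set.inter_eq_left.2 hsub] at this


/-! ### The trace -/

/-- `SmoothTendstoW1` only asserts that some weak gradient is the limit; comparing two sequences
requires these limits to agree, by the fundamental lemma of the calculus of variations. -/
theorem IsWeakGradient.ae_eq {Ω : Set (E n)} (hΩ : IsOpen Ω) {p : ℝ≥0∞} (hp : 1 ≤ p)
    {u : E n → ℝ} {G G' : E n → E n} (hGp : MemLp G p (volume.restrict Ω))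
    (hGp' : MemLp G' p (volume.restrict Ω)) (hG : IsWeakGradient Ω u G)
    (hG' : IsWeakGradient Ω u G') : G =ᵐ[volume.restrict Ω] G' := by
  have hl : ∀ {H : E n → E n}, MemLp H p (volume.restrict Ω) → ∀ {φ : E n → ℝ},
      IsTestFunction Ω φ → Integrable (fun x => φ x • H x) (volume.restrict Ω) := by
    intro H hH φ hφ
    have h1 := hφ.1.continuous
    have h2 : LocallyIntegrable H (volume.restrict Ω) := hH.locallyIntegrable hp
    exact h2.integrable_smul_left_of_hasCompactSupport h1 hφ.2.1
  have hloc : LocallyIntegrableOn (fun x => G x - G' x) Ω volume := by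
    exact locallyIntegrableOn_of_locallyIntegrable_restrict ((hGp.sub hGp').locallyIntegrable hp)
  have h := hΩ.ae_eq_zero_of_integral_contDiff_smul_eq_zero hloc fun φ h1 h2 h3 => by
    have hφ : IsTestFunction Ω φ := ⟨h1, h2, h3⟩
    have hs : ∫ x, φ x • (G x - G' x) = ∫ x in Ω, φ x • (G x - G' x) := by
      rw [setIntegral_eq_integral_of_forall_compl_eq_zero]
      intro x hx
      rw [image_eq_zero_of_notMem_tsupport fun hx' => hx (h3 hx'), zero_smul]
    have hint : Integrable (fun x => φ x • (G x - G' x)) (volume.restrict Ω) := by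
      simp only [smul_sub]
      exact (hl hGp hφ).sub (hl hGp' hφ)
    rw [hs]
    refine ext_inner_left ℝ fun v => ?_
    rw [← integral_inner hint, inner_zero_right]
    have e1 : ∀ {H : E n → E n}, MemLp H p (volume.restrict Ω) →
        Integrable (fun x => ⟪H x, v⟫ * φ x) (volume.restrict Ω) := fun hH => by
      refine ((hl hH hφ).const_inner v).congr (.of_forall fun x => ?_)
      simp [inner_smul_right, real_inner_comm, mul_comm]
    have e2 : ∀ x, ⟪v, φ x • (G x - G' x)⟫ = ⟪G x, v⟫ * φ x - ⟪G' x, v⟫ * φ x := fun x => by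
      rw [inner_smul_right, inner_sub_right, real_inner_comm v, real_inner_comm v]; ring
    simp_rw [e2]
    rw [integral_sub (e1 hGp) (e1 hGp'), sub_eq_zero]
    exact neg_injective ((hG φ hφ v).symm.trans (hG' φ hφ v))
  filter_upwards [(ae_restrict_iff' hΩ.measurableSet).2 h] with x hx
  exact sub_eq_zero.1 hx

theorem gradient_fun_sub {φ ψ : E n → ℝ} (hφ : ContDiff ℝ ∞ φ) (hψ : ContDiff ℝ ∞ ψ) (x : E n) :
    gradient (fun x => φ x - ψ x) x = gradient φ x - gradient ψ x := by
  simp only [gradient]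
  rw [fderiv_fun_sub (hφ.differentiable (by simp) x) (hψ.differentiable (by simp) x), map_sub]

theorem IsLipschitzDomain.exists_eLpNorm_trace_le {Ω : Set (E n)} (hΩ : IsLipschitzDomain Ω)
    {p : ℝ≥0∞} (hp : 1 ≤ p) (hp' : p ≠ ⊤) :
    ∃ C : ℝ≥0, ∀ φ : E n → ℝ, ContDiff ℝ ∞ φ → eLpNorm φ p (surfaceMeasure Ω) ≤
      C * (eLpNorm φ p (volume.restrict Ω) + eLpNorm (gradient φ) p (volume.restrict Ω)) := by
  obtain ⟨C, hC⟩ := hΩ.exists_trace_inequality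
  have hp0 : p ≠ 0 := (zero_lt_one.trans_le hp).ne'
  have hpr : 1 ≤ p.toReal := by
    rw [← ENNReal.toReal_one]; exact (ENNReal.toReal_le_toReal (by simp) hp').2 hp
  have hpi : 0 ≤ 1 / p.toReal := by positivity
  refine ⟨C ^ (1 / p.toReal), fun φ hφ => ?_⟩
  calc eLpNorm φ p (surfaceMeasure Ω)
      ≤ (C : ℝ≥0∞) ^ (1 / p.toReal) *
          eLpNorm (fun x => ‖φ x‖ + ‖gradient φ x‖) p (volume.restrict Ω) := by
        rw [eLpNorm_eq_lintegral_rpow_enorm_toReal hp0 hp',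
          eLpNorm_eq_lintegral_rpow_enorm_toReal hp0 hp', ← ENNReal.mul_rpow_of_nonneg _ _ hpi]
        gcongr
        refine (hC _ hpr φ hφ).trans_eq ?_
        congr 1
        refine lintegral_congr fun x => ?_
        rw [Real.enorm_of_nonneg (r := ‖φ x‖ + ‖gradient φ x‖) (by positivity), ENNReal.ofReal_add (norm_nonneg _) (norm_nonneg _),
          ofReal_norm, ofReal_norm]
    _ ≤ _ := by
        rw [ENNReal.coe_rpow_of_nonneg _ hpi]
        gcongr
        refine (eLpNorm_add_le hφ.continuous.norm.aestronglyMeasurable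
          (continuous_gradient hφ).norm.aestronglyMeasurable hp).trans_eq ?_
        rw [eLpNorm_norm, eLpNorm_norm]

/-- The trace inequality for `φ = 1` bounds the surface measure by a multiple of the volume of `Ω`.
-/
theorem IsLipschitzDomain.isFiniteMeasure_surfaceMeasure {Ω : Set (E n)}
    (hΩ : IsLipschitzDomain Ω) : IsFiniteMeasure (surfaceMeasure Ω) := by
  obtain ⟨C, hC⟩ := hΩ.exists_trace_inequality
  refine ⟨?_⟩
  have h := hC 1 le_rfl (fun _ => 1) contDiff_const
  have hg : ∀ x : E n, gradient (fun _ : E n => (1 : ℝ)) x = 0 := fun x => by simp [gradient]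
  simp only [hg, enorm_one, ENNReal.one_rpow, enorm_zero, add_zero, lintegral_const, one_mul,
    Measure.restrict_apply_univ] at h
  exact h.trans_lt (ENNReal.mul_lt_top ENNReal.coe_lt_top hΩ.2.1.measure_lt_top)

theorem IsLipschitzDomain.isCompact_frontier {Ω : Set (E n)} (hΩ : IsLipschitzDomain Ω) :
    IsCompact (frontier Ω) :=
  hΩ.2.1.isCompact_closure.of_isClosed_subset isClosed_frontier frontier_subset_closure

theorem IsLipschitzDomain.memLp_surfaceMeasure {Ω : Set (E n)} (hΩ : IsLipschitzDomain Ω)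
    {f : E n → ℝ} (hf : ContinuousOn f (frontier Ω)) (p : ℝ≥0∞) :
    MemLp f p (surfaceMeasure Ω) := by
  have := hΩ.isFiniteMeasure_surfaceMeasure
  obtain ⟨C, hC⟩ := hΩ.isCompact_frontier.exists_bound_of_continuousOn hf
  refine MemLp.of_bound (hf.aestronglyMeasurable isClosed_frontier.measurableSet) C ?_
  exact (ae_restrict_iff' isClosed_frontier.measurableSet).2 (.of_forall hC)

/-- If two sequences of smooth functions converge in `W^{1,p}(Ω)` to the same function, along
possibly different index maps, the boundary values of their difference tend to `0`. -/
theorem IsLipschitzDomain.tendsto_eLpNorm_surfaceMeasure_sub {Ω : Set (E n)}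
    (hΩ : IsLipschitzDomain Ω) {p : ℝ≥0∞} (hp : 1 ≤ p) (hp' : p ≠ ⊤) {φ ψ : ℕ → E n → ℝ}
    {u : E n → ℝ} (hφ : SmoothTendstoW1 Ω p φ u) (hψ : SmoothTendstoW1 Ω p ψ u) {ι : Type*}
    {l : Filter ι} {a b : ι → ℕ} (ha : Tendsto a l atTop) (hb : Tendsto b l atTop) :
    Tendsto (fun i => eLpNorm (fun x => φ (a i) x - ψ (b i) x) p (surfaceMeasure Ω)) l (𝓝 0) := by
  obtain ⟨C, hC⟩ := hΩ.exists_eLpNorm_trace_le hp hp'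
  obtain ⟨hφs, hu, G, hGp, hG, h1, h2⟩ := hφ
  obtain ⟨hψs, -, G', hGp', hG', h1', h2'⟩ := hψ
  have hGG := IsWeakGradient.ae_eq hΩ.1 hp hGp' hGp hG' hG
  have h2'' : Tendsto (fun k => eLpNorm (fun x => gradient (ψ k) x - G x) p (volume.restrict Ω))
      atTop (𝓝 0) := by
    refine h2'.congr fun k => eLpNorm_congr_ae ?_
    filter_upwards [hGG] with x hx
    rw [hx]
  have hlim := ENNReal.Tendsto.const_mul (a := (C : ℝ≥0∞))
    (((h1.comp ha).add (h1'.comp hb)).add ((h2.comp ha).add (h2''.comp hb)))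
    (Or.inr ENNReal.coe_ne_top)
  simp only [add_zero, mul_zero] at hlim
  refine tendsto_of_tendsto_of_tendsto_of_le_of_le tendsto_const_nhds hlim
    (fun _ => zero_le) fun i => ?_
  have key : ∀ {F : Type} [NormedAddCommGroup F] {f g w : E n → F},
      AEStronglyMeasurable f (volume.restrict Ω) → AEStronglyMeasurable g (volume.restrict Ω) →
      AEStronglyMeasurable w (volume.restrict Ω) →
      eLpNorm (fun x => f x - g x) p (volume.restrict Ω) ≤
        eLpNorm (fun x => f x - w x) p (volume.restrict Ω) +
        eLpNorm (fun x => g x - w x) p (volume.restrict Ω) := by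
    intro F _ f g w hf hg hw
    have := eLpNorm_sub_le (hf.sub hw) (hg.sub hw) hp
    refine le_trans (le_of_eq ?_) this
    congr 1
    ext x
    simp
  refine (hC _ ((hφs _).sub (hψs _))).trans ?_
  simp only [Function.comp]
  gcongr
  · exact key (hφs _).continuous.aestronglyMeasurable (hψs _).continuous.aestronglyMeasurable hu.1
  · rw [show gradient (fun x => φ (a i) x - ψ (b i) x) =
      fun x => gradient (φ (a i)) x - gradient (ψ (b i)) x from
      funext fun x => gradient_fun_sub (hφs _) (hψs _) x]
    exact key (continuous_gradient (hφs _)).aestronglyMeasurable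
      (continuous_gradient (hψs _)).aestronglyMeasurable hGp.1

theorem IsLipschitzDomain.exists_smoothTendstoW1 {Ω : Set (E n)} (hΩ : IsLipschitzDomain Ω)
    {p : ℝ≥0∞} (hp : 1 ≤ p) (hp' : p ≠ ⊤) {u : E n → ℝ} (hu : MemW1 Ω p u) :
    ∃ φ, SmoothTendstoW1 Ω p φ u ∧
      (ContinuousOn u (closure Ω) → TendstoUniformlyOn φ u atTop (closure Ω)) := by
  obtain ⟨hu, G, hGp, hG⟩ := hu
  obtain ⟨φ, hφs, h1, h2, h3⟩ := hΩ.exists_smooth_approx hp hp' hu hGp hG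
  exact ⟨φ, ⟨hφs, hu, G, hGp, hG, h1, h2⟩, h3⟩

theorem IsLipschitzDomain.exists_isTrace {Ω : Set (E n)} (hΩ : IsLipschitzDomain Ω)
    {p : ℝ≥0∞} (hp : 1 ≤ p) (hp' : p ≠ ⊤) {u : E n → ℝ} (hu : MemW1 Ω p u) :
    ∃ g, IsTrace Ω p u g := by
  obtain ⟨φ, hφ, -⟩ := hΩ.exists_smoothTendstoW1 hp hp' hu
  have : Fact (1 ≤ p) := ⟨hp⟩
  have hmem : ∀ k, MemLp (φ k) p (surfaceMeasure Ω) := fun k =>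
    hΩ.memLp_surfaceMeasure (hφ.1 k).continuous.continuousOn p
  have hcau : CauchySeq fun k => (hmem k).toLp (φ k) := by
    rw [Lp.cauchySeq_Lp_iff_cauchySeq_eLpNorm]
    -- Comparing the sequence with itself along the two projections of `ℕ × ℕ` is the Cauchy
    -- property.
    have h := hΩ.tendsto_eLpNorm_surfaceMeasure_sub hp hp' hφ hφ
      (l := (atTop : Filter (ℕ × ℕ))) (a := Prod.fst) (b := Prod.snd)
      (by rw [← prod_atTop_atTop_eq]; exact tendsto_fst)
      (by rw [← prod_atTop_atTop_eq]; exact tendsto_snd)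
    refine h.congr fun i => eLpNorm_congr_ae ?_
    filter_upwards [(hmem i.1).coeFn_toLp, (hmem i.2).coeFn_toLp] with x h1 h2
    simp only [Pi.sub_apply, h1, h2]
  obtain ⟨g, hg⟩ := cauchySeq_tendsto_of_complete hcau
  refine ⟨g, Lp.memLp g, φ, hφ, ?_⟩
  have h := (Lp.tendsto_Lp_iff_tendsto_eLpNorm' _ g).1 hg
  refine h.congr fun k => eLpNorm_congr_ae ?_
  filter_upwards [(hmem k).coeFn_toLp] with x h1
  simp only [Pi.sub_apply, h1]

theorem IsLipschitzDomain.isTrace_ae_eq {Ω : Set (E n)} (hΩ : IsLipschitzDomain Ω)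
    {p : ℝ≥0∞} (hp : 1 ≤ p) (hp' : p ≠ ⊤) {u g g' : E n → ℝ} (hg : IsTrace Ω p u g)
    (hg' : IsTrace Ω p u g') : g' =ᵐ[surfaceMeasure Ω] g := by
  obtain ⟨hgp, φ, hφ, h1⟩ := hg
  obtain ⟨hgp', ψ, hψ, h1'⟩ := hg'
  have h2 := hΩ.tendsto_eLpNorm_surfaceMeasure_sub hp hp' hψ hφ tendsto_id tendsto_id
  have hlim := (h1'.add h2).add h1
  simp only [add_zero, id] at hlim
  have h3 : eLpNorm (g' - g) p (surfaceMeasure Ω) = 0 := by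
    refine le_antisymm (ge_of_tendsto' hlim fun k => ?_) zero_le
    have e1 := (hψ.1 k).continuous.aestronglyMeasurable (μ := surfaceMeasure Ω)
    have e2 := (hφ.1 k).continuous.aestronglyMeasurable (μ := surfaceMeasure Ω)
    rw [show eLpNorm (fun x => ψ k x - g' x) p (surfaceMeasure Ω) =
      eLpNorm (g' - ψ k) p (surfaceMeasure Ω) from eLpNorm_sub_comm (ψ k) g' p _]
    have e3 : g' - g = (g' - ψ k) + (ψ k - φ k) + (φ k - g) := by abel
    rw [e3]
    refine (eLpNorm_add_le ((hgp'.1.sub e1).add (e1.sub e2)) (e2.sub hgp.1) hp).trans ?_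
    gcongr
    · exact eLpNorm_add_le (hgp'.1.sub e1) (e1.sub e2) hp
    · exact le_rfl
  rw [eLpNorm_eq_zero_iff (hgp'.1.sub hgp.1) (zero_lt_one.trans_le hp).ne'] at h3
  filter_upwards [h3] with x hx
  exact sub_eq_zero.1 hx

theorem IsLipschitzDomain.isTrace_self {Ω : Set (E n)} (hΩ : IsLipschitzDomain Ω)
    {p : ℝ≥0∞} (hp : 1 ≤ p) (hp' : p ≠ ⊤) {u : E n → ℝ} (hu : MemW1 Ω p u)
    (hc : ContinuousOn u (closure Ω)) : IsTrace Ω p u u := by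
  obtain ⟨φ, hφ, h⟩ := hΩ.exists_smoothTendstoW1 hp hp' hu
  have hfin := hΩ.isFiniteMeasure_surfaceMeasure
  refine ⟨hΩ.memLp_surfaceMeasure (hc.mono frontier_subset_closure) p, φ, hφ, ?_⟩
  have hunif := Metric.tendstoUniformlyOn_iff.1 (h hc)
  set A := surfaceMeasure Ω Set.univ ^ p.toReal⁻¹ with hA
  have hAtop : A ≠ ⊤ := ENNReal.rpow_ne_top_of_nonneg (by positivity) (measure_ne_top _ _)
  have hlim : Tendsto (fun ε : ℝ => A * ENNReal.ofReal ε) (𝓝[>] 0) (𝓝 0) := by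
    have := ENNReal.Tendsto.const_mul (a := A)
      ((ENNReal.continuous_ofReal.tendsto 0).mono_left (nhdsWithin_le_nhds (s := Set.Ioi 0)))
      (Or.inr hAtop)
    simpa using this
  rw [ENNReal.tendsto_nhds_zero]
  intro η hη
  obtain ⟨ε, hε, hε0⟩ := ((ENNReal.tendsto_nhds_zero.1 hlim η hη).and self_mem_nhdsWithin).exists
  filter_upwards [hunif ε hε0] with k hk
  refine (eLpNorm_le_of_ae_bound (C := ε) ?_).trans hε
  refine (ae_restrict_iff' isClosed_frontier.measurableSet).2 (.of_forall fun x hx => ?_)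
  rw [← dist_eq_norm, dist_comm]
  exact (hk x (frontier_subset_closure hx)).le


/-! ### Functions with zero trace -/

/-- Smooth cutoff functions equal to `1` off the boundary layer of width `δ`, with gradient at most
`4 / δ`. -/
theorem exists_cutoff {Ω : Set (E n)} (hb : Bornology.IsBounded Ω) {δ : ℝ}
    (hδ : 0 < δ) :
    ∃ χ : E n → ℝ, IsTestFunction Ω χ ∧ (∀ x, 0 ≤ χ x ∧ χ x ≤ 1) ∧
      (∀ x, ‖gradient χ x‖ ≤ 4 / δ) ∧
      ∀ x ∈ Ω \ boundaryLayer Ω δ, χ x = 1 ∧ gradient χ x = 0 := by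
  obtain ⟨k, hk, hks⟩ := exists_isMollifier (0 : E n) (show 0 < δ / 8 by positivity)
  set D : E n → ℝ := fun x => Metric.infDist x Ωᶜ with hD
  have hDl : LipschitzWith 1 D := Metric.lipschitz_infDist_pt _
  have hD0 : ∀ x, 0 ≤ D x := fun x => Metric.infDist_nonneg
  set f : E n → ℝ := fun x => min (max 0 (4 / δ * (D x - δ / 4))) 1 with hf
  have hfl : LipschitzWith (Real.toNNReal (4 / δ)) f := by
    refine LipschitzWith.min_const (LipschitzWith.const_max (LipschitzWith.of_dist_le_mul
      fun x y => ?_) 0) 1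
    rw [Real.coe_toNNReal _ (by positivity), Real.dist_eq, ← mul_sub, abs_mul,
      abs_of_pos (show 0 < 4 / δ by positivity), sub_sub_sub_cancel_right, ← Real.dist_eq]
    gcongr
    simpa using hDl.dist_le_mul x y
  have hfli : LocallyIntegrable f := hfl.continuous.locallyIntegrable
  have hf0 : ∀ x, D x ≤ δ / 4 → f x = 0 := fun x hx => by
    have : 4 / δ * (D x - δ / 4) ≤ 0 :=
      mul_nonpos_of_nonneg_of_nonpos (by positivity) (by linarith)
    simp [hf, max_eq_left this]
  have hf1 : ∀ x, δ / 2 ≤ D x → f x = 1 := fun x hx => by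
    have h1 : 1 ≤ 4 / δ * (D x - δ / 4) := by
      rw [div_mul_eq_mul_div, le_div_iff₀ hδ]; linarith
    simp only [hf]
    rw [max_eq_right (by linarith), min_eq_right h1]
  have hDk : ∀ x, ∀ y ∈ Function.support k, |D (x - y) - D x| ≤ δ / 8 := fun x y hy => by
    have h1 := mem_ball_zero_iff.1 (hks hy)
    have h2 := hDl.dist_le_mul (x - y) x
    rw [Real.dist_eq, dist_eq_norm, sub_sub_cancel_left, norm_neg, NNReal.coe_one, one_mul] at h2
    linarith
  have hχ0 : ∀ x, D x < δ / 8 → mollify k f x = 0 := fun x hx => by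
    have := hk.norm_mollify_sub_le hfli (x := x) (c := 0) (δ := 0) fun y hy => by
      rw [hf0 _ (by linarith [(abs_le.1 (hDk x y hy)).2])]; simp
    simpa using this
  have hχ1 : ∀ x, 3 / 4 * δ < D x → mollify k f x = 1 := fun x hx => by
    have := hk.norm_mollify_sub_le hfli (x := x) (c := 1) (δ := 0) fun y hy => by
      rw [hf1 _ (by linarith [(abs_le.1 (hDk x y hy)).1])]; simp
    rw [norm_le_zero_iff, sub_eq_zero] at this
    exact this
  have hsupp : tsupport (mollify k f) ⊆ {x | δ / 8 ≤ D x} :=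
    closure_minimal (fun x hx => not_lt.1 fun h => hx (hχ0 x h))
      (isClosed_le continuous_const hDl.continuous)
  have hsuppΩ : tsupport (mollify k f) ⊆ Ω := fun x hx => by
    by_contra hxΩ
    have h1 : D x = 0 := Metric.infDist_zero_of_mem hxΩ
    have h2 : δ / 8 ≤ D x := hsupp hx
    linarith
  refine ⟨mollify k f, ⟨hk.contDiff_mollify hfli, ?_, hsuppΩ⟩, fun x => ?_, fun x => ?_,
    fun x hx => ?_⟩
  · exact hb.isCompact_closure.of_isClosed_subset (isClosed_tsupport _) (hsuppΩ.trans subset_closure)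
  · have := hk.norm_mollify_sub_le hfli (x := x) (c := 1 / 2) (δ := 1 / 2) fun y _ => by
      have h1 : 0 ≤ f (x - y) := le_min (le_max_left _ _) zero_le_one
      have h2 : f (x - y) ≤ 1 := min_le_right _ _
      rw [Real.norm_eq_abs, abs_le]
      constructor <;> linarith
    rw [Real.norm_eq_abs, abs_le] at this
    constructor <;> linarith [this.1, this.2]
  · rw [norm_gradient]
    have := norm_fderiv_le_of_lipschitz ℝ (hk.lipschitzWith_mollify hfl) (x₀ := x)
    rwa [Real.coe_toNNReal _ (by positivity)] at this
  · have h1 : δ ≤ D x := not_lt.1 fun h => hx.2 ⟨hx.1, h⟩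
    have h2 : 3 / 4 * δ < D x := by linarith
    refine ⟨hχ1 x h2, ?_⟩
    have : mollify k f =ᶠ[𝓝 x] fun _ => (1 : ℝ) := by
      filter_upwards [(isOpen_lt continuous_const hDl.continuous).mem_nhds h2] with y hy
      exact hχ1 y hy
    rw [gradient, this.fderiv_eq]; simp

theorem IsTestFunction.mul_right {Ω : Set (E n)} {χ φ : E n → ℝ} (hχ : IsTestFunction Ω χ)
    (hφ : ContDiff ℝ ∞ φ) : IsTestFunction Ω fun x => χ x * φ x :=
  ⟨hχ.1.mul hφ, hχ.2.1.mul_right, (tsupport_mul_subset_left (f := χ) (g := φ)).trans hχ.2.2⟩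

/-- The layers decrease to the empty set inside a set of finite measure, so absolute continuity of
the integral applies. The complement must be nonempty, since `infDist` to the empty set is `0`. -/
theorem tendsto_setLIntegral_boundaryLayer {Ω : Set (E n)} (hn : 1 ≤ n) (hΩ : IsOpen Ω)
    (hb : Bornology.IsBounded Ω) {F : Type*} [NormedAddCommGroup F] {f : E n → F}
    (hf : MemLp f 1 (volume.restrict Ω)) {δ : ℕ → ℝ} (hδ : Antitone δ)
    (hδ0 : Tendsto δ atTop (𝓝 0)) :
    Tendsto (fun m => ∫⁻ x in boundaryLayer Ω (δ m), ‖f x‖ₑ) atTop (𝓝 0) := by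
  have hne : (Ωᶜ).Nonempty := by
    rw [Set.nonempty_compl]
    rintro rfl
    have : Nonempty (Fin n) := ⟨⟨0, hn⟩⟩
    exact NormedSpace.unbounded_univ ℝ (E n) hb
  have hlayer : ∀ m, volume.restrict (boundaryLayer Ω (δ m)) =
      (volume.restrict Ω).restrict (boundaryLayer Ω (δ m)) := fun m => by
    rw [Measure.restrict_restrict (isOpen_boundaryLayer hΩ _).measurableSet,
      Set.inter_eq_left.2 fun x hx => hx.1]
  have hfin : IsFiniteMeasure (volume.restrict Ω) :=
    ⟨by rw [Measure.restrict_apply_univ]; exact hb.measure_lt_top⟩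
  simp_rw [hlayer]
  refine tendsto_setLIntegral_zero ?_ ?_
  · have := hf.2
    rw [eLpNorm_one_eq_lintegral_enorm] at this
    exact this.ne
  · have h := tendsto_measure_iInter_atTop (μ := volume.restrict Ω)
      (s := fun m => boundaryLayer Ω (δ m))
      (fun m => (isOpen_boundaryLayer hΩ _).measurableSet.nullMeasurableSet)
      (fun a b hab => boundaryLayer_mono Ω (hδ hab)) ⟨0, measure_ne_top _ _⟩
    have hempty : ⋂ m, boundaryLayer Ω (δ m) = ∅ := by
      refine Set.eq_empty_of_forall_notMem fun x hx => ?_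
      rw [Set.mem_iInter] at hx
      have h1 : Metric.infDist x Ωᶜ ≤ 0 := ge_of_tendsto' hδ0 fun m => (hx m).2.le
      have h2 := (hΩ.isClosed_compl.notMem_iff_infDist_pos hne).1 (not_not.2 (hx 0).1)
      linarith
    rwa [hempty, measure_empty] at h

theorem MemW1Zero.isTrace_zero {Ω : Set (E n)} (hΩ : IsOpen Ω) {p : ℝ≥0∞} {u : E n → ℝ}
    (hu : MemW1Zero Ω p u) : MemW1 Ω p u ∧ IsTrace Ω p u 0 := by
  obtain ⟨φ, hφ, hlim⟩ := hu
  obtain ⟨hs, hup, G, hGp, hG, h1, h2⟩ := hlim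
  refine ⟨⟨hup, G, hGp, hG⟩, MemLp.zero, φ, ⟨hs, hup, G, hGp, hG, h1, h2⟩, ?_⟩
  refine tendsto_const_nhds.congr fun k => ?_
  rw [eLpNorm_congr_ae (g := 0), eLpNorm_zero]
  refine (ae_restrict_iff' isClosed_frontier.measurableSet).2 (.of_forall fun x hx => ?_)
  rw [hΩ.frontier_eq] at hx
  simp [image_eq_zero_of_notMem_tsupport fun h => hx.2 ((hφ k).2.2 h)]

/-- The approximants are `χ m * φ m`. Because `δ m` cancels in the estimate of `φ m ∇χ m`, the
widths need not be adapted to the speed of convergence of `φ m`. -/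
theorem IsLipschitzDomain.memW1Zero_of_isTrace_zero {Ω : Set (E n)} (hn : 1 ≤ n)
    (hΩ : IsLipschitzDomain Ω) {u : E n → ℝ} (hu : IsTrace Ω 1 u 0) : MemW1Zero Ω 1 u := by
  obtain ⟨-, φ, ⟨hφs, hup, G, hGp, hG, h1, h2⟩, h3⟩ := hu
  obtain ⟨C, M, δ₀, hδ₀, H⟩ := hΩ.exists_boundaryLayer_inequality hn
  have hΩm := hΩ.1.measurableSet
  -- The shift by `2` keeps `δ m < δ₀` strict already at `m = 0`.
  set δ : ℕ → ℝ := fun m => δ₀ / ((m : ℝ) + 2) with hδdef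
  have hδpos : ∀ m, 0 < δ m := fun m => by positivity
  have hδlt : ∀ m, δ m < δ₀ := fun m => by
    rw [hδdef]; exact div_lt_self hδ₀ (by linarith [(Nat.cast_nonneg m : (0 : ℝ) ≤ m)])
  have hδanti : Antitone δ := fun a b hab => by
    simp only [hδdef]; gcongr
  have hδlim : Tendsto δ atTop (𝓝 0) :=
    tendsto_const_nhds.div_atTop (tendsto_atTop_add_const_right _ _ tendsto_natCast_atTop_atTop)
  choose χ hχt hχ01 hχg hχ1 using fun m => exists_cutoff hΩ.2.1 (hδpos m)
  -- The layer of width `N * δ m` contains those of widths `δ m` and `M * δ m`.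
  set N : ℝ := M + 1 with hN
  have hlayer : ∀ {F : Type} [NormedAddCommGroup F] {f : E n → F}, MemLp f 1 (volume.restrict Ω) →
      Tendsto (fun m => ∫⁻ x in boundaryLayer Ω (N * δ m), ‖f x‖ₑ) atTop (𝓝 0) := fun hf =>
    tendsto_setLIntegral_boundaryLayer hn hΩ.1 hΩ.2.1 hf
      (fun a b hab => mul_le_mul_of_nonneg_left (hδanti hab) (by positivity))
      (by simpa using hδlim.const_mul N)
  have hM0 : (0 : ℝ) ≤ M := M.2
  have hsub1 : ∀ m, boundaryLayer Ω (δ m) ⊆ boundaryLayer Ω (N * δ m) := fun m =>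
    boundaryLayer_mono Ω (by nlinarith [hδpos m])
  have hsub2 : ∀ m, boundaryLayer Ω (M * δ m) ⊆ boundaryLayer Ω (N * δ m) := fun m =>
    boundaryLayer_mono Ω (by nlinarith [hδpos m])
  have hBm : ∀ r, MeasurableSet (boundaryLayer Ω r) := fun r =>
    (isOpen_boundaryLayer hΩ.1 r).measurableSet
  have hBΩ : ∀ r, boundaryLayer Ω r ⊆ Ω := fun r x hx => hx.1
  simp only [eLpNorm_one_eq_lintegral_enorm, Pi.zero_apply, sub_zero] at h1 h2 h3
  have hχe : ∀ m x, ‖χ m x‖ₑ ≤ 1 ∧ ‖χ m x - 1‖ₑ ≤ 1 := fun m x => by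
    rw [← enorm_one (G := ℝ), enorm_le_iff_norm_le, enorm_le_iff_norm_le, norm_one,
      Real.norm_eq_abs, Real.norm_eq_abs, abs_le, abs_le]
    refine ⟨⟨?_, ?_⟩, ?_, ?_⟩ <;> linarith [(hχ01 m x).1, (hχ01 m x).2]
  refine ⟨fun m x => χ m x * φ m x, fun m => (hχt m).mul_right (hφs m),
    fun m => (hχt m).1.mul (hφs m), hup, G, hGp, hG, ?_, ?_⟩
  · simp only [eLpNorm_one_eq_lintegral_enorm]
    have hlim := h1.add (hlayer hup)
    rw [add_zero] at hlim
    refine tendsto_of_tendsto_of_tendsto_of_le_of_le tendsto_const_nhds hlim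
      (fun _ => zero_le) fun m => ?_
    calc ∫⁻ x in Ω, ‖χ m x * φ m x - u x‖ₑ
        ≤ ∫⁻ x in Ω, (‖φ m x - u x‖ₑ + (boundaryLayer Ω (δ m)).indicator (fun x => ‖u x‖ₑ) x) := by
          refine setLIntegral_mono' hΩm fun x hx => ?_
          by_cases hxl : x ∈ boundaryLayer Ω (δ m)
          · rw [Set.indicator_of_mem hxl,
              show χ m x * φ m x - u x = χ m x * (φ m x - u x) + (χ m x - 1) * u x by ring]
            refine (enorm_add_le _ _).trans ?_
            rw [enorm_mul, enorm_mul]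
            exact add_le_add (mul_le_of_le_one_left zero_le (hχe m x).1)
              (mul_le_of_le_one_left zero_le (hχe m x).2)
          · rw [(hχ1 m x ⟨hx, hxl⟩).1, one_mul]
            exact le_self_add
      _ = (∫⁻ x in Ω, ‖φ m x - u x‖ₑ) + ∫⁻ x in boundaryLayer Ω (δ m), ‖u x‖ₑ := by
          have hum : AEMeasurable (fun x => ‖φ m x - u x‖ₑ) (volume.restrict Ω) :=
            ((hφs m).continuous.aestronglyMeasurable.sub hup.1).enorm
          rw [lintegral_add_left' hum,
            setLIntegral_indicator (hBm _), Set.inter_eq_left.2 (hBΩ _)]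
      _ ≤ _ := by gcongr; exact hsub1 m
  · simp only [eLpNorm_one_eq_lintegral_enorm]
    have hlim := (h2.add (hlayer hGp)).add (ENNReal.Tendsto.const_mul (a := (4 * C : ℝ≥0∞))
      (h3.add (h2.add (hlayer hGp))) (Or.inr (by finiteness)))
    simp only [add_zero, mul_zero] at hlim
    refine tendsto_of_tendsto_of_tendsto_of_le_of_le tendsto_const_nhds hlim
      (fun _ => zero_le) fun m => ?_
    have hprod : ∀ x, gradient (fun x => χ m x * φ m x) x =
        χ m x • gradient (φ m) x + φ m x • gradient (χ m) x := fun x => by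
      simpa using gradient_sum_mul (ι := Unit) (fun _ => (hχt m).1) (fun _ => hφs m) x
    have hGm : AEMeasurable (fun x => ‖gradient (φ m) x - G x‖ₑ) (volume.restrict Ω) :=
      ((continuous_gradient (hφs m)).aestronglyMeasurable.sub hGp.1).enorm
    -- The cutoff term: `4 / δ m` meets the factor `δ m` of the boundary layer inequality. The
    -- gradient of `φ m` on the layer is then split as `(∇φ m - G) + G`, and both parts tend to `0`.
    have hcut : ∫⁻ x in boundaryLayer Ω (δ m), ENNReal.ofReal (4 / δ m) * ‖φ m x‖ₑ ≤
        4 * C * (∫⁻ y, ‖φ m y‖ₑ ∂(surfaceMeasure Ω) + ((∫⁻ x in Ω, ‖gradient (φ m) x - G x‖ₑ) +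
          ∫⁻ x in boundaryLayer Ω (N * δ m), ‖G x‖ₑ)) := by
      rw [lintegral_const_mul' _ _ ENNReal.ofReal_ne_top]
      calc _ ≤ ENNReal.ofReal (4 / δ m) * (C * ENNReal.ofReal (δ m) *
            (∫⁻ y, ‖φ m y‖ₑ ∂(surfaceMeasure Ω) +
              ∫⁻ x in boundaryLayer Ω (M * δ m), ‖gradient (φ m) x‖ₑ)) := by
            gcongr
            exact H _ (hδpos m) (hδlt m) _ (hφs m)
        _ = 4 * C * (∫⁻ y, ‖φ m y‖ₑ ∂(surfaceMeasure Ω) +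
              ∫⁻ x in boundaryLayer Ω (M * δ m), ‖gradient (φ m) x‖ₑ) := by
            have : ENNReal.ofReal (4 / δ m) * ENNReal.ofReal (δ m) = 4 := by
              rw [← ENNReal.ofReal_mul (by have := hδpos m; positivity),
                div_mul_cancel₀ _ (hδpos m).ne']
              simp
            rw [← mul_assoc, mul_left_comm, this, mul_comm (C : ℝ≥0∞)]
        _ ≤ _ := by
            gcongr
            calc ∫⁻ x in boundaryLayer Ω (M * δ m), ‖gradient (φ m) x‖ₑ
                ≤ ∫⁻ x in boundaryLayer Ω (M * δ m), (‖gradient (φ m) x - G x‖ₑ + ‖G x‖ₑ) :=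
                  lintegral_mono fun x => by
                    have := enorm_add_le (gradient (φ m) x - G x) (G x)
                    rwa [sub_add_cancel] at this
              _ = (∫⁻ x in boundaryLayer Ω (M * δ m), ‖gradient (φ m) x - G x‖ₑ) +
                    ∫⁻ x in boundaryLayer Ω (M * δ m), ‖G x‖ₑ :=
                  lintegral_add_left' (hGm.mono_measure (Measure.restrict_mono (hBΩ _) le_rfl)) _
              _ ≤ _ := add_le_add (lintegral_mono_set (hBΩ _)) (lintegral_mono_set (hsub2 m))
    calc ∫⁻ x in Ω, ‖gradient (fun x => χ m x * φ m x) x - G x‖ₑ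
        ≤ ∫⁻ x in Ω, (‖gradient (φ m) x - G x‖ₑ + (boundaryLayer Ω (δ m)).indicator
            (fun x => ENNReal.ofReal (4 / δ m) * ‖φ m x‖ₑ + ‖G x‖ₑ) x) := by
          refine setLIntegral_mono' hΩm fun x hx => ?_
          rw [hprod]
          by_cases hxl : x ∈ boundaryLayer Ω (δ m)
          · rw [Set.indicator_of_mem hxl,
              show χ m x • gradient (φ m) x + φ m x • gradient (χ m) x - G x =
                χ m x • (gradient (φ m) x - G x) + (φ m x • gradient (χ m) x + (χ m x - 1) • G x) by
                rw [smul_sub, sub_smul, one_smul]; abel]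
            refine (enorm_add_le _ _).trans (add_le_add ?_
              ((enorm_add_le _ _).trans (add_le_add ?_ ?_)))
            · rw [enorm_smul]
              exact mul_le_of_le_one_left zero_le (hχe m x).1
            · rw [enorm_smul, mul_comm]
              gcongr
              rw [← ofReal_norm]
              exact ENNReal.ofReal_le_ofReal (hχg m x)
            · rw [enorm_smul]
              exact mul_le_of_le_one_left zero_le (hχe m x).2
          · rw [(hχ1 m x ⟨hx, hxl⟩).1, (hχ1 m x ⟨hx, hxl⟩).2, one_smul, smul_zero, add_zero]
            exact le_self_add
      _ = (∫⁻ x in Ω, ‖gradient (φ m) x - G x‖ₑ) +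
            ((∫⁻ x in boundaryLayer Ω (δ m), ENNReal.ofReal (4 / δ m) * ‖φ m x‖ₑ) +
              ∫⁻ x in boundaryLayer Ω (δ m), ‖G x‖ₑ) := by
          rw [lintegral_add_left' hGm, setLIntegral_indicator (hBm _),
            Set.inter_eq_left.2 (hBΩ _), lintegral_add_left]
          exact (hφs m).continuous.enorm.measurable.const_mul _
      _ ≤ (∫⁻ x in Ω, ‖gradient (φ m) x - G x‖ₑ) +
            (4 * C * (∫⁻ y, ‖φ m y‖ₑ ∂(surfaceMeasure Ω) + ((∫⁻ x in Ω, ‖gradient (φ m) x - G x‖ₑ) +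
          ∫⁻ x in boundaryLayer Ω (N * δ m), ‖G x‖ₑ)) +
              ∫⁻ x in boundaryLayer Ω (N * δ m), ‖G x‖ₑ) := by
          gcongr
          exact hsub1 m
      _ = _ := by ring

end SobolevTrace

theorem mainTheorem9 (n : ℕ) (hn : 1 ≤ n) (Ω : Set (SobolevTrace.E n))
    (hΩ : SobolevTrace.IsLipschitzDomain Ω) :
    -- the trace is well defined on `W^{1,p}(Ω)`, and it is `u` for `u ∈ C⁰(closure Ω)`
    (∀ p : ℝ≥0∞, 1 ≤ p → p ≠ ⊤ →
      (∀ u : SobolevTrace.E n → ℝ, SobolevTrace.MemW1 Ω p u →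
        ∃ g : SobolevTrace.E n → ℝ, SobolevTrace.IsTrace Ω p u g ∧
          ∀ g' : SobolevTrace.E n → ℝ, SobolevTrace.IsTrace Ω p u g' →
            g' =ᵐ[SobolevTrace.surfaceMeasure Ω] g) ∧
      (∀ u : SobolevTrace.E n → ℝ, SobolevTrace.MemW1 Ω p u → ContinuousOn u (closure Ω) →
        SobolevTrace.IsTrace Ω p u u)) ∧
    -- `W^{1,1}_0(Ω) = {u ∈ W^{1,1}(Ω) : tr u = 0}`
    {u : SobolevTrace.E n → ℝ | SobolevTrace.MemW1Zero Ω 1 u} =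
      {u : SobolevTrace.E n → ℝ | SobolevTrace.MemW1 Ω 1 u ∧ SobolevTrace.IsTrace Ω 1 u 0} := by
  refine ⟨fun p hp hp' => ⟨fun u hu => ?_, fun u hu hc => hΩ.isTrace_self hp hp' hu hc⟩, ?_⟩
  · obtain ⟨g, hg⟩ := hΩ.exists_isTrace hp hp' hu
    exact ⟨g, hg, fun g' hg' => hΩ.isTrace_ae_eq hp hp' hg hg'⟩
  · ext u
    exact ⟨fun hu => hu.isTrace_zero hΩ.1, fun hu => hΩ.memW1Zero_of_isTrace_zero hn hu.2⟩
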